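/- Work in $V$. All embeddings below are elementary embeddings $j:V\to M$ into a transitive class $M\subseteq V$, and $\operatorname{crit}(j)$ is the critical point of $j$. Let $\kappa$ be a cardinal and $\lambda\ge\kappa$ an ordinal. * For a set $A$, $\kappa$ is $\lambda$-strong for $A$ if there is $j:V\to M$ with $\operatorname{crit}(j)=\kappa$, $j(\kappa)>\lambda$, $V_\lambda\subseteq M$ and $A\cap V_\lambda=j(A)\cap V_\lambda$. * $\kappa$ is $\lambda$-supercompact if there is $j:V\to M$ with $\operatorname{crit}(j)=\kappa$, $j(\kappa)>\lambda$ and ${}^{\lambda}M\subseteq M$. * For a set of ordinals $A$, $\kappa$ is $\lambda$-strongly compact for $A$ if there is $j:V\to M$ with $\operatorname{crit}(j)=\kappa$, $j(\kappa)>\lambda$ and $A\cap\lambda=j(A)\cap\lambda$ that has the $\lambda$-covering property: for every set $X\subseteq M$ with $|X|\le\lambda$ there is $s\in M$ such that $X\subseteq s$ and $M\models|s|<j(\kappa)$. For a cardinal $\delta$, $\kappa$ is ${<}\delta$-strong for $A$ (${<}\delta$-supercompact, ${<}\delta$-strongly compact for $A$) if the corresponding property holds for all $\lambda$ with $\kappa\le\lambda<\delta$.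 A cardinal $\delta$ is Woodin if for every $A\subseteq V_\delta$ there is a cardinal $\kappa<\delta$ which is ${<}\delta$-strong for $A$; it is Woodin for strong compactness if for every $A\subseteq\delta$ there is a cardinal $\kappa<\delta$ which is ${<}\delta$-strongly compact for $A$. **Proposition 3.4.** Let $\delta$ be a Woodin cardinal, and suppose that the ${<}\delta$-supercompact cardinals below $\delta$ are unbounded in $\delta$. Then $\delta$ is Woodin for strong compactness. -/

import Mathlib

/-!
The universe `V` is `ZFSet.{u}`, and a class is an arbitrary `M : Set ZFSet.{u}`.
The von Neumann ordinal of `o : Ordinal.{u}` is `o.toZFSet`, and a cardinal `κ` is identified with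
its initial ordinal `κ.ord`.
-/

universe u

namespace LargeCardinal

open FirstOrder ZFSet

/-- The only symbol of the language of set theory is the binary relation `∈`. -/
inductive MemRel : ℕ → Type
  | mem : MemRel 2

/-- The first-order language `{∈}` of set theory. -/
def setLang : Language := ⟨fun _ => Empty, MemRel⟩

/-- The universe as the structure `(V, ∈)`. -/
instance universeStructure : setLang.Structure ZFSet.{u} where
  funMap := fun f => Empty.elim f
  RelMap | .mem => fun x => x 0 ∈ x 1

/-- A class `M` as the structure `(M, ∈)`. -/
instance classStructure (M : Set ZFSet.{u}) : setLang.Structure M where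
  funMap := fun f => Empty.elim f
  RelMap | .mem => fun x => (x 0 : ZFSet.{u}) ∈ (x 1 : ZFSet.{u})

/-- `M` is a transitive class. -/
def IsTransitiveClass (M : Set ZFSet.{u}) : Prop :=
  ∀ x ∈ M, ∀ y ∈ x, y ∈ M

/-- An elementary embedding `j : V → M` into a transitive class `M ⊆ V`. Elementarity is for all
first-order formulas of the language of set theory. -/
structure Emb where
  /-- the target class `M` -/
  M : Set ZFSet.{u}
  transitive : IsTransitiveClass M
  /-- the embedding, as a map from `V` to the subtype of elements of `M` -/
  toM : setLang.ElementaryEmbedding ZFSet.{u} M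

/-- The value `j(x)`, as an element of `V`. -/
def Emb.app (j : Emb.{u}) (x : ZFSet.{u}) : ZFSet.{u} := (j.toM x : ZFSet.{u})

/-- `crit(j) = α`: the ordinal `α` is the least ordinal moved by `j`. -/
def Emb.IsCrit (j : Emb.{u}) (α : Ordinal.{u}) : Prop :=
  j.app α.toZFSet ≠ α.toZFSet ∧ ∀ β < α, j.app β.toZFSet = β.toZFSet

/-- `crit(j) = κ` and `j(κ) > l`. -/
def Emb.CritAbove (j : Emb.{u}) (κ : Cardinal.{u}) (l : Ordinal.{u}) : Prop :=
  j.IsCrit κ.ord ∧ l.toZFSet ∈ j.app κ.ord.toZFSet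

/-- `M ⊨ |s| < θ`, for a transitive class `M` and `θ` a cardinal of `M`: some `f ∈ M` is a
bijection of `s` with an element of `θ`. -/
def CardLtIn (M : Set ZFSet.{u}) (s θ : ZFSet.{u}) : Prop :=
  ∃ α ∈ θ, ∃ f ∈ M, IsFunc s α f ∧ ∀ y ∈ α, ∃! x, pair x y ∈ f

/-- The `l`-covering property of an embedding `j` with critical point `κ`: every set `X ⊆ M` with
`|X| ≤ l` is covered by some `s ∈ M` with `M ⊨ |s| < j(κ)`. -/
def Emb.Covering (j : Emb.{u}) (κ : Cardinal.{u}) (l : Ordinal.{u}) : Prop :=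
  ∀ X : ZFSet.{u}, (∀ x ∈ X, x ∈ j.M) → X.card ≤ l.card →
    ∃ s ∈ j.M, X ⊆ s ∧ CardLtIn j.M s (j.app κ.ord.toZFSet)

/-- `M` is closed under `l`-sequences, `ˡM ⊆ M`: every function with domain `l` and values in `M`
is an element of `M`. -/
def ClosedUnderSeq (M : Set ZFSet.{u}) (l : Ordinal.{u}) : Prop :=
  ∀ f y : ZFSet.{u}, IsFunc l.toZFSet y f → (∀ z ∈ y, z ∈ M) → f ∈ M

/-- `κ` is `l`-strong for `A`: some `j : V → M` has `crit(j) = κ`, `j(κ) > l`, `V_l ⊆ M` and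
`A ∩ V_l = j(A) ∩ V_l`. -/
def IsStrongFor (κ : Cardinal.{u}) (l : Ordinal.{u}) (A : ZFSet.{u}) : Prop :=
  ∃ j : Emb.{u}, j.CritAbove κ l ∧ (∀ x ∈ vonNeumann l, x ∈ j.M) ∧
    A ∩ vonNeumann l = j.app A ∩ vonNeumann l

/-- `κ` is `l`-supercompact: some `j : V → M` has `crit(j) = κ`, `j(κ) > l` and `ˡM ⊆ M`. -/
def IsSupercompact (κ : Cardinal.{u}) (l : Ordinal.{u}) : Prop :=
  ∃ j : Emb.{u}, j.CritAbove κ l ∧ ClosedUnderSeq j.M l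

/-- `κ` is `l`-strongly compact for the set of ordinals `A`: some `j : V → M` has `crit(j) = κ`,
`j(κ) > l`, the `l`-covering property and `A ∩ l = j(A) ∩ l`. -/
def IsStronglyCompactFor (κ : Cardinal.{u}) (l : Ordinal.{u}) (A : ZFSet.{u}) : Prop :=
  ∃ j : Emb.{u}, j.CritAbove κ l ∧ j.Covering κ l ∧ A ∩ l.toZFSet = j.app A ∩ l.toZFSet

/-- The property `P l` for all ordinals `κ ≤ l < δ`. -/
def Below (κ δ : Cardinal.{u}) (P : Ordinal.{u} → Prop) : Prop :=
  ∀ l : Ordinal.{u}, κ.ord ≤ l → l < δ.ord → P l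

/-- `δ` is Woodin: for every `A ⊆ V_δ` there is `κ < δ` which is `<δ`-strong for `A`. -/
def IsWoodin (δ : Cardinal.{u}) : Prop :=
  ∀ A : ZFSet.{u}, A ⊆ vonNeumann δ.ord → ∃ κ < δ, Below κ δ fun l => IsStrongFor κ l A

/-- `δ` is Woodin for strong compactness: for every `A ⊆ δ` there is `κ < δ` which is
`<δ`-strongly compact for `A`. -/
def IsWoodinForStrongCompactness (δ : Cardinal.{u}) : Prop :=
  ∀ A : ZFSet.{u}, A ⊆ δ.ord.toZFSet → ∃ κ < δ, Below κ δ fun l => IsStronglyCompactFor κ l A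

end LargeCardinal

/-! Fix `A ⊆ δ`. Code `V_δ`, `A` and the set `B` of `<δ`-supercompact cardinals below `δ` into one
set `C ⊆ V_δ`, and let `κ` be `<δ`-strong for `C`. Given `κ ≤ l < δ`, choose `μ ∈ B` above `l` and
let `j` witness strength for `C` up to `θ = μ⁺`. Then `V_θ ⊆ M`, `j(A)` agrees with `A` below `θ`,
and `μ ∈ j(B)` with `μ < j(κ)`. Morally, `j`, cut down to its extender with seeds in `V_θ`, is
followed by the ultrapower by a fine measure at `μ`. That second map has critical point `μ > l`, so
it disturbs neither `crit(j) = κ` nor `A ∩ l`, and fineness supplies the covers.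

Both steps are carried out at once, as an ultrapower of `V`. Its elements are classes of functions
`f (p c) g`. Here `p` assigns a point to each seed `c ∈ V_θ`, distributed by `{X | c ∈ j(X)}`
(`Emb.exists_generic`), and `g` is drawn from `U (p μ)`, where `U x` is a fine `x`-complete
ultrafilter for `x ∈ B ∩ κ` (`IsSupercompact.exists_isFineUltrafilter`). The Tarski–Vaught test
gives Łoś's theorem (`exists_seedUltrapower`); countable completeness gives well-foundedness, so the
model collapses to a transitive class. Completeness of `U (p μ)` keeps every ordinal `≤ l` in place
(`eq_ord_of_smem`).

For covering (`exists_cover`), let `x_ξ = [f_ξ, c_ξ]` for `ξ < l`. The sequence of seeds `c_ξ` is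
itself a seed, since `θ` is regular, and the range of `g` almost surely contains any given `ξ < l`.
The set of all values `f_ξ (c) g`, with `c` in the sequence and `ξ` in the range of `g`, is the
cover; almost surely it has size `< κ`, because `l < j(κ)` and `μ < j(κ)`. -/

namespace LargeCardinal

open FirstOrder ZFSet Ordinal Filter

/-! ### First-order definable predicates and transitive models -/

/-- The symbol `∈`. -/
def memSymb : setLang.Relations 2 := MemRel.mem

/-- The interpretation of `∈` in a structure for the language of set theory. -/
def SMem {S : Type*} [setLang.Structure S] (x y : S) : Prop :=
  Language.Structure.RelMap memSymb ![x, y]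

/-- A predicate on all structures for the language of set theory that is uniformly defined by a
single first-order formula. -/
def FO {ι : Type} (P : ∀ (S : Type (u + 1)) [setLang.Structure S], (ι → S) → Prop) : Prop :=
  ∃ φ : setLang.Formula ι, ∀ (S : Type (u + 1)) [setLang.Structure S] (v : ι → S),
    φ.Realize v ↔ P S v

namespace FO

variable {ι : Type} {P Q : ∀ (S : Type (u + 1)) [setLang.Structure S], (ι → S) → Prop}

theorem mem (i k : ι) : FO.{u} fun S _ (v : ι → S) => SMem (v i) (v k) :=
  ⟨memSymb.formula₂ (.var i) (.var k), fun S _ v => by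
    simp [SMem]⟩

theorem eq (i k : ι) : FO.{u} fun S _ (v : ι → S) => v i = v k :=
  ⟨Language.Term.equal (.var i) (.var k), fun S _ v => by simp⟩

theorem not (hP : FO P) : FO fun S _ v => ¬ P S v := by
  obtain ⟨φ, hφ⟩ := hP
  exact ⟨φ.not, fun S _ v => by simp [hφ]⟩

theorem imp (hP : FO P) (hQ : FO Q) : FO fun S _ v => P S v → Q S v := by
  obtain ⟨φ, hφ⟩ := hP
  obtain ⟨ψ, hψ⟩ := hQ
  exact ⟨φ.imp ψ, fun S _ v => by simp [hφ, hψ]⟩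

theorem and (hP : FO P) (hQ : FO Q) : FO fun S _ v => P S v ∧ Q S v := by
  obtain ⟨φ, hφ⟩ := hP
  obtain ⟨ψ, hψ⟩ := hQ
  exact ⟨φ ⊓ ψ, fun S _ v => by simp [hφ, hψ]⟩

theorem or (hP : FO P) (hQ : FO Q) : FO fun S _ v => P S v ∨ Q S v := by
  obtain ⟨φ, hφ⟩ := hP
  obtain ⟨ψ, hψ⟩ := hQ
  exact ⟨φ ⊔ ψ, fun S _ v => by simp [hφ, hψ]⟩

theorem iff (hP : FO P) (hQ : FO Q) : FO fun S _ v => P S v ↔ Q S v := by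
  obtain ⟨φ, hφ⟩ := hP
  obtain ⟨ψ, hψ⟩ := hQ
  exact ⟨φ.iff ψ, fun S _ v => by simp [hφ, hψ]⟩

theorem all {P : ∀ (S : Type (u + 1)) [setLang.Structure S], (ι → S) → S → Prop}
    (hP : FO fun S _ (w : ι ⊕ Unit → S) => P S (w ∘ Sum.inl) (w (Sum.inr ()))) :
    FO fun S _ v => ∀ x, P S v x := by
  obtain ⟨φ, hφ⟩ := hP
  refine ⟨φ.iAlls Unit, fun S _ v => ?_⟩
  rw [Language.Formula.realize_iAlls]
  simp only [hφ]
  exact ⟨fun h x => h fun _ => x, fun h x => h (x ())⟩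

theorem ex {P : ∀ (S : Type (u + 1)) [setLang.Structure S], (ι → S) → S → Prop}
    (hP : FO fun S _ (w : ι ⊕ Unit → S) => P S (w ∘ Sum.inl) (w (Sum.inr ()))) :
    FO fun S _ v => ∃ x, P S v x := by
  obtain ⟨φ, hφ⟩ := hP
  refine ⟨φ.iExs Unit, fun S _ v => ?_⟩
  rw [Language.Formula.realize_iExs]
  simp only [hφ]
  exact ⟨fun ⟨x, h⟩ => ⟨x (), h⟩, fun ⟨x, h⟩ => ⟨fun _ => x, h⟩⟩

theorem comp {κ : Type} (hP : FO P) (g : ι → κ) : FO fun S _ (v : κ → S) => P S (v ∘ g) := by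
  obtain ⟨φ, hφ⟩ := hP
  exact ⟨φ.relabel g, fun S _ v => by simp [hφ]⟩

theorem realize_iff (hP : FO P) {S T : Type (u + 1)} [setLang.Structure S] [setLang.Structure T]
    (f : S ↪ₑ[setLang] T) (v : ι → S) : P T (f ∘ v) ↔ P S v := by
  obtain ⟨φ, hφ⟩ := hP
  rw [← hφ, ← hφ, f.map_formula]

end FO

/-- `z = (x, y)` in the sense of a structure. -/
def SPair {S : Type*} [setLang.Structure S] (z x y : S) : Prop :=
  ∃ a, SMem a z ∧ ∃ b, SMem b z ∧ (∀ w, SMem w z → w = a ∨ w = b) ∧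
    (SMem x a ∧ ∀ w, SMem w a → w = x) ∧ SMem x b ∧ SMem y b ∧ ∀ w, SMem w b → w = x ∨ w = y

theorem FO.pair {ι : Type} (i k l : ι) :
    FO.{u} fun S _ (v : ι → S) => SPair (v i) (v k) (v l) := by
  unfold SPair
  repeat' first
    | exact FO.mem _ _ | exact FO.eq _ _ | apply FO.ex | apply FO.all | apply FO.and | apply FO.or
    | apply FO.imp

/-- `val` identifies a structure with a transitive class. -/
structure TransitiveModel {S : Type*} [setLang.Structure S] (val : S → ZFSet.{u}) : Prop where
  injective : Function.Injective val
  mem_iff : ∀ x y, SMem x y ↔ val x ∈ val y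
  exists_of_mem : ∀ x, ∀ z ∈ val x, ∃ y, val y = z

theorem pair_iff {x y z : ZFSet.{u}} : z = pair x y ↔
    ∃ a ∈ z, ∃ b ∈ z, (∀ w ∈ z, w = a ∨ w = b) ∧ (x ∈ a ∧ ∀ w ∈ a, w = x) ∧
      x ∈ b ∧ y ∈ b ∧ ∀ w ∈ b, w = x ∨ w = y := by
  constructor
  · rintro rfl
    refine ⟨{x}, by simp [pair], {x, y}, by simp [pair], ?_, ?_, ?_, ?_, ?_⟩ <;>
      simp [pair]
  · rintro ⟨a, ha, b, hb, h, h1, h2, h3, h4⟩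
    have ha' : a = {x} := by
      ext w
      simp only [mem_singleton]
      exact ⟨h1.2 w, fun h => h ▸ h1.1⟩
    have hb' : b = {x, y} := by
      ext w
      simp only [mem_pair]
      exact ⟨h4 w, by rintro (rfl | rfl) <;> assumption⟩
    ext w
    rw [pair, mem_pair, ← ha', ← hb']
    exact ⟨h w, by rintro (rfl | rfl) <;> assumption⟩

namespace TransitiveModel

variable {S : Type*} [setLang.Structure S] {val : S → ZFSet.{u}}

theorem forall_mem (h : TransitiveModel val) (x : S) (P : ZFSet.{u} → Prop) :
    (∀ y ∈ val x, P y) ↔ ∀ y, SMem y x → P (val y) := by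
  refine ⟨fun H y hy => H _ ((h.mem_iff _ _).1 hy), fun H y hy => ?_⟩
  obtain ⟨y, rfl⟩ := h.exists_of_mem x y hy
  exact H y ((h.mem_iff _ _).2 hy)

theorem exists_mem (h : TransitiveModel val) (x : S) (P : ZFSet.{u} → Prop) :
    (∃ y ∈ val x, P y) ↔ ∃ y, SMem y x ∧ P (val y) := by
  refine ⟨fun ⟨y, hy, H⟩ => ?_, fun ⟨y, hy, H⟩ => ⟨_, (h.mem_iff _ _).1 hy, H⟩⟩
  obtain ⟨y, rfl⟩ := h.exists_of_mem x y hy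
  exact ⟨y, (h.mem_iff _ _).2 hy, H⟩

theorem pair_iff (h : TransitiveModel val) (z x y : S) :
    SPair z x y ↔ val z = pair (val x) (val y) := by
  rw [LargeCardinal.pair_iff]
  simp only [SPair, h.exists_mem, h.forall_mem, h.injective.eq_iff, h.mem_iff]

end TransitiveModel

theorem transitiveModel_id : TransitiveModel (id : ZFSet.{u} → ZFSet.{u}) where
  injective := Function.injective_id
  mem_iff _ _ := Iff.rfl
  exists_of_mem _ z _ := ⟨z, rfl⟩

theorem smem_zfset {x y : ZFSet.{u}} : SMem x y ↔ x ∈ y := Iff.rfl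

theorem spair_zfset {z x y : ZFSet.{u}} : SPair z x y ↔ z = pair x y :=
  transitiveModel_id.pair_iff z x y

/-! ### Elementarity of an embedding into a transitive class -/

namespace Emb

variable (j : Emb.{u})

theorem transitiveModel : TransitiveModel (Subtype.val : j.M → ZFSet.{u}) where
  injective := Subtype.val_injective
  mem_iff _ _ := Iff.rfl
  exists_of_mem x z hz := ⟨⟨z, j.transitive _ x.2 _ hz⟩, rfl⟩

theorem smem_iff {x y : j.M} : SMem x y ↔ (x : ZFSet.{u}) ∈ (y : ZFSet.{u}) := Iff.rfl

theorem spair_iff {z x y : j.M} : SPair z x y ↔ (z : ZFSet.{u}) = pair x.1 y.1 :=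
  j.transitiveModel.pair_iff z x y

theorem app_mem (x : ZFSet.{u}) : j.app x ∈ j.M := (j.toM x).2

theorem mem_of_mem_app {x y : ZFSet.{u}} (h : x ∈ j.app y) : x ∈ j.M :=
  j.transitive _ (j.app_mem y) _ h

theorem transfer {ι : Type} {P : ∀ (S : Type (u + 1)) [setLang.Structure S], (ι → S) → Prop}
    (hP : FO P) (v : ι → ZFSet.{u}) : P j.M (j.toM ∘ v) ↔ P ZFSet v :=
  hP.realize_iff j.toM v

theorem app_mem_app {x y : ZFSet.{u}} : j.app x ∈ j.app y ↔ x ∈ y :=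
  j.transfer (P := fun _ _ v => SMem (v 0) (v 1)) (FO.mem 0 1) ![x, y]

/-- Elementarity for separation. -/
theorem mem_app_sep {ι : Type}
    {P : ∀ (S : Type (u + 1)) [setLang.Structure S], (ι → S) → S → Prop}
    (hP : FO fun S _ (w : ι ⊕ Unit → S) => P S (w ∘ Sum.inl) (w (Sum.inr ())))
    (D : ZFSet.{u}) (q : ι → ZFSet.{u}) (c : j.M) :
    c.1 ∈ j.app (D.sep (P ZFSet q)) ↔ c.1 ∈ j.app D ∧ P j.M (j.toM ∘ q) c := by
  have := (j.transfer (P := fun S _ (v : ι ⊕ Bool → S) =>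
    ∀ x, SMem x (v (Sum.inr true)) ↔ SMem x (v (Sum.inr false)) ∧ P S (v ∘ Sum.inl) x) (by
      apply FO.all
      refine FO.iff (FO.mem _ _) (FO.and (FO.mem _ _) ?_)
      exact hP.comp (Sum.map Sum.inl id))
    (Sum.elim q fun b => if b then D.sep (P ZFSet q) else D)).2 fun x => by
      simp [smem_zfset, Sum.elim_comp_inl]
  have := this c
  exact this

theorem app_mono {x y : ZFSet.{u}} (h : x ⊆ y) : j.app x ⊆ j.app y := by
  intro z hz
  have := (j.transfer (P := fun S _ v => ∀ z, SMem z (v 0) → SMem z (v 1)) (by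
    repeat' first | exact FO.mem _ _ | apply FO.all | apply FO.imp) ![x, y]).2 fun z hz => h hz
  exact this ⟨z, j.mem_of_mem_app hz⟩ hz

theorem app_empty : j.app ∅ = ∅ := by
  refine (ZFSet.eq_empty _).2 fun z hz => ?_
  have := (j.transfer (P := fun S _ v => ∀ z, ¬ SMem z (v ())) (by
    repeat' first | exact FO.mem _ _ | apply FO.all | apply FO.not) fun _ => ∅).2
      fun z => notMem_empty z
  exact this ⟨z, j.mem_of_mem_app hz⟩ hz

theorem app_insert (x y : ZFSet.{u}) : j.app (insert x y) = insert (j.app x) (j.app y) := by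
  have := (j.transfer (P := fun S _ v => ∀ z, SMem z (v 2) ↔ z = v 0 ∨ SMem z (v 1)) (by
    repeat' first
      | exact FO.mem _ _ | exact FO.eq _ _ | apply FO.all | apply FO.iff | apply FO.or)
    ![x, y, insert x y]).2 fun z => mem_insert_iff
  ext z
  rw [mem_insert_iff]
  constructor
  · intro hz
    have h := (this ⟨z, j.mem_of_mem_app hz⟩).1 hz
    exact h.imp (congrArg Subtype.val) id
  · rintro (rfl | hz)
    · exact (this (j.toM x)).2 (.inl rfl)
    · exact (this ⟨z, j.mem_of_mem_app hz⟩).2 (.inr hz)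

theorem app_singleton (x : ZFSet.{u}) : j.app {x} = {j.app x} := by
  have := j.app_insert x ∅
  rwa [j.app_empty, insert_empty_eq, insert_empty_eq] at this

theorem app_natCast (n : ℕ) : j.app (n : Ordinal.{u}).toZFSet = (n : Ordinal.{u}).toZFSet := by
  induction n with
  | zero => simp [j.app_empty]
  | succ n ih => rw [Nat.cast_add, Nat.cast_one, toZFSet_add_one, j.app_insert, ih]

/-- By elementarity each element of `j(ω)` is empty or the successor of an element of `j(ω)`, so
`∈`-induction shows that no new element appears. Nothing about the critical point is used. -/
theorem mem_omega_of_mem_app {x : ZFSet.{u}} (hx : x ∈ j.app Ordinal.omega0.toZFSet) :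
    x ∈ Ordinal.omega0.toZFSet := by
  have key := (j.transfer (P := fun S _ v => ∀ x, SMem x (v ()) → (∀ z, ¬ SMem z x) ∨
      ∃ y, SMem y (v ()) ∧ ∀ z, SMem z x ↔ z = y ∨ SMem z y) (by
    repeat' first
      | exact FO.mem _ _ | exact FO.eq _ _ | apply FO.ex | apply FO.all | apply FO.iff | apply FO.or
      | apply FO.and | apply FO.not | apply FO.imp) fun _ => Ordinal.omega0.toZFSet).2 (by
    intro x hx
    obtain ⟨a, ha, rfl⟩ := mem_toZFSet_iff.1 hx
    obtain ⟨n, rfl⟩ := Ordinal.lt_omega0.1 ha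
    cases n with
    | zero => exact .inl fun z => by simp [smem_zfset]
    | succ n =>
      refine .inr ⟨(n : Ordinal).toZFSet, ?_, fun z => ?_⟩
      · exact toZFSet_mem_toZFSet_iff.2 (Ordinal.natCast_lt_omega0 n)
      · rw [smem_zfset, Nat.cast_add, Nat.cast_one, toZFSet_add_one, mem_insert_iff]
        rfl)
  induction x using ZFSet.inductionOn with
  | h x ih =>
    rcases key ⟨x, j.mem_of_mem_app hx⟩ hx with h | ⟨y, hy, h⟩
    · have : x = ∅ := (ZFSet.eq_empty _).2 fun z hz =>
        h ⟨z, j.transitive _ (j.mem_of_mem_app hx) _ hz⟩ hz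
      rw [this, ← toZFSet_zero]
      exact toZFSet_mem_toZFSet_iff.2 Ordinal.omega0_pos
    · have hyx : y.1 ∈ x := (h y).2 (.inl rfl)
      obtain ⟨a, ha, hay⟩ := mem_toZFSet_iff.1 (ih y hyx hy)
      have : x = (a + 1).toZFSet := by
        ext z
        rw [toZFSet_add_one, hay, mem_insert_iff]
        constructor
        · intro hz
          have h' := (h ⟨z, j.transitive _ (j.mem_of_mem_app hx) _ hz⟩).1 hz
          exact h'.imp (congrArg Subtype.val) id
        · rintro (rfl | hz)
          · exact hyx
          · exact (h ⟨z, j.transitive _ y.2 _ hz⟩).2 (.inr hz)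
      rw [this, toZFSet_mem_toZFSet_iff]
      exact Ordinal.isSuccLimit_omega0.add_one_lt ha

theorem isTransitive_app {x : ZFSet.{u}} (hx : x.IsTransitive) : (j.app x).IsTransitive := by
  intro y hy z hz
  have := (j.transfer (P := fun S _ v => ∀ y, SMem y (v ()) → ∀ z, SMem z y → SMem z (v ())) (by
    repeat' first | exact FO.mem _ _ | apply FO.all | apply FO.imp) fun _ => x).2
      fun y hy z hz => hx y hy hz
  have hyM := j.mem_of_mem_app hy
  exact this ⟨y, hyM⟩ hy ⟨z, j.transitive _ hyM _ hz⟩ hz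

end Emb

/-! ### Derived ultrafilters and functions of a seed -/

/-- The function `t` restricted to `D`, as a set of pairs. -/
noncomputable def graph (D : ZFSet.{u}) (t : ZFSet.{u} → ZFSet.{u}) : ZFSet.{u} :=
  ZFSet.range fun x : D => pair x.1 (t x.1)

theorem pair_mem_graph {D : ZFSet.{u}} {t : ZFSet.{u} → ZFSet.{u}} {x y : ZFSet.{u}} :
    pair x y ∈ graph D t ↔ x ∈ D ∧ t x = y := by
  simp only [graph, mem_range, pair_inj]
  constructor
  · rintro ⟨⟨z, hz⟩, rfl, rfl⟩
    exact ⟨hz, rfl⟩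
  · rintro ⟨hx, rfl⟩
    exact ⟨⟨x, hx⟩, rfl, rfl⟩

/-- The first component of an ordered pair. -/
noncomputable def fst (z : ZFSet.{u}) : ZFSet.{u} := Classical.epsilon fun x => ∃ y, z = pair x y

/-- The second component of an ordered pair. -/
noncomputable def snd (z : ZFSet.{u}) : ZFSet.{u} := Classical.epsilon fun y => ∃ x, z = pair x y

/-- The value at `x` of a set of pairs `z`. -/
noncomputable def valueAt (x z : ZFSet.{u}) : ZFSet.{u} := Classical.epsilon fun y => pair x y ∈ z

@[simp]
theorem fst_pair (x y : ZFSet.{u}) : fst (pair x y) = x := by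
  have := Classical.epsilon_spec (p := fun a => ∃ b, pair x y = pair a b) ⟨x, y, rfl⟩
  obtain ⟨b, hb⟩ := this
  exact (pair_inj.1 hb).1.symm

@[simp]
theorem snd_pair (x y : ZFSet.{u}) : snd (pair x y) = y := by
  have := Classical.epsilon_spec (p := fun b => ∃ a, pair x y = pair a b) ⟨y, x, rfl⟩
  obtain ⟨b, hb⟩ := this
  exact (pair_inj.1 hb).2.symm

theorem valueAt_eq {x y z : ZFSet.{u}} (h : pair x y ∈ z) (h' : ∀ y', pair x y' ∈ z → y' = y) :
    valueAt x z = y :=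
  h' _ (Classical.epsilon_spec (p := fun y => pair x y ∈ z) ⟨y, h⟩)

/-- `x` is a single-valued set of pairs with domain contained in an element of `K`, in the sense of
a structure. -/
def SFunLt {S : Type*} [setLang.Structure S] (x K : S) : Prop :=
  (∃ β, SMem β K ∧ ∀ w, SMem w x → ∃ s, SMem s β ∧ ∃ y, SPair w s y) ∧
    ∀ w, SMem w x → ∀ w', SMem w' x → ∀ s y y', SPair w s y → SPair w' s y' → y = y'

/-- `x` is a single-valued set of pairs with domain contained in an element of `K`. -/
def FunLt (x K : ZFSet.{u}) : Prop :=
  (∃ β ∈ K, ∀ w ∈ x, ∃ s ∈ β, ∃ y, w = pair s y) ∧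
    ∀ s y y', pair s y ∈ x → pair s y' ∈ x → y = y'

theorem sfunLt_iff {x K : ZFSet.{u}} : SFunLt x K ↔ FunLt x K := by
  simp only [SFunLt, FunLt, smem_zfset, spair_zfset]
  refine and_congr Iff.rfl ⟨fun h s y y' hy hy' => h _ hy _ hy' s y y' rfl rfl, ?_⟩
  rintro h w hw w' hw' s y y' rfl rfl
  exact h s y y' hw hw'

theorem FunLt.of_subset {x y K L : ZFSet.{u}} (h : FunLt x K) (hxy : y ⊆ x) (hK : K ⊆ L) :
    FunLt y L := by
  obtain ⟨⟨β, hβ, h1⟩, h2⟩ := h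
  exact ⟨⟨β, hK hβ, fun w hw => h1 w (hxy hw)⟩, fun s a b ha hb => h2 s a b (hxy ha) (hxy hb)⟩

namespace Emb

variable (j : Emb.{u})

theorem sfunLt {x K : j.M} (h : FunLt x.1 K.1) : SFunLt x K := by
  obtain ⟨⟨β, hβ, h1⟩, h2⟩ := h
  simp only [SFunLt, j.smem_iff, j.spair_iff]
  refine ⟨⟨⟨β, j.transitive _ K.2 _ hβ⟩, hβ, fun w hw => ?_⟩, fun w hw w' hw' s y y' hy hy' => ?_⟩
  · obtain ⟨s, hs, y, hy⟩ := h1 w hw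
    have hsM : s ∈ j.M := j.transitive _ (j.transitive _ K.2 _ hβ) _ hs
    have hyM : y ∈ j.M := by
      have h3 : ({s, y} : ZFSet) ∈ w.1 := by rw [hy]; simp [pair]
      exact j.transitive _ (j.transitive _ w.2 _ h3) _ (by simp)
    exact ⟨⟨s, hsM⟩, hs, ⟨y, hyM⟩, hy⟩
  · rw [hy] at hw
    rw [hy'] at hw'
    exact Subtype.ext (h2 _ _ _ hw hw')

/-- The ultrafilter `{X | c ∈ j(X)}` derived from `j` and a seed `c ∈ j(D)`. -/
noncomputable def derived (D c : ZFSet.{u}) (hc : c ∈ j.app D) : Ultrafilter ZFSet.{u} :=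
  Ultrafilter.ofComplNotMemIff
    { sets := {s | c ∈ j.app (D.sep (· ∈ s))}
      univ_sets := by
        have : D.sep (· ∈ Set.univ) = D := by ext; simp
        simpa only [Set.mem_ofPred_eq, this]
      sets_of_superset := fun {s t} hs hst =>
        j.app_mono (fun x hx => mem_sep.2 ⟨(mem_sep.1 hx).1, hst (mem_sep.1 hx).2⟩) hs
      inter_sets := fun {s t} hs ht => by
        have := (j.mem_app_sep (P := fun S _ (v : Unit → S) x => SMem x (v ())) (FO.mem _ _)
          (D.sep (· ∈ s)) (fun _ => D.sep (· ∈ t)) ⟨c, j.mem_of_mem_app hc⟩).2 ⟨hs, ht⟩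
        refine j.app_mono (fun x hx => ?_) this
        simp only [smem_zfset, mem_sep] at hx
        exact mem_sep.2 ⟨hx.1.1, hx.1.2, hx.2.2⟩ }
    fun s => by
      have := j.mem_app_sep (P := fun S _ (v : Unit → S) x => ¬ SMem x (v ())) (FO.mem _ _).not
          D (fun _ => D.sep (· ∈ s)) ⟨c, j.mem_of_mem_app hc⟩
      have h : D.sep (fun x => ¬ SMem x (D.sep (· ∈ s))) = D.sep (· ∈ sᶜ) := by
        ext x
        simp only [smem_zfset, mem_sep, Set.mem_compl_iff]
        tauto
      rw [h] at this
      change ¬ c ∈ j.app (D.sep (· ∈ sᶜ)) ↔ c ∈ j.app (D.sep (· ∈ s))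
      rw [this]
      change ¬ (c ∈ _ ∧ ¬ c ∈ j.app (D.sep (· ∈ s))) ↔ _
      tauto

section Derived

variable {j} {D c : ZFSet.{u}} (hc : c ∈ j.app D)

theorem eventually_derived {P : ZFSet.{u} → Prop} :
    (∀ᶠ x in j.derived D c hc, P x) ↔ c ∈ j.app (D.sep P) := Iff.rfl

theorem eventually_mem_derived : ∀ᶠ x in j.derived D c hc, x ∈ D := by
  rw [eventually_derived]
  have : D.sep (· ∈ D) = D := by ext; simp
  rwa [this]

theorem eventually_derived_iff {ι : Type}
    {P : ∀ (S : Type (u + 1)) [setLang.Structure S], (ι → S) → S → Prop}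
    (hP : FO fun S _ (w : ι ⊕ Unit → S) => P S (w ∘ Sum.inl) (w (Sum.inr ())))
    (q : ι → ZFSet.{u}) :
    (∀ᶠ x in j.derived D c hc, P ZFSet q x) ↔
      P j.M (j.toM ∘ q) ⟨c, j.mem_of_mem_app hc⟩ := by
  have := j.mem_app_sep hP D q ⟨c, j.mem_of_mem_app hc⟩
  rw [eventually_derived, this]
  exact and_iff_right hc

/-- Put `s = {(n, x) | x ∈ X n}`. If `c ∈ j(X n)` for all `n`, then `(n, c) ∈ j(s)` for every `n ∈
ω`. Since `j(ω)` has no further elements, `c` satisfies the image of the statement "`(n, x) ∈ s` for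
all `n ∈ ω`", which therefore holds for almost every `x`. -/
instance : CountableInterFilter (j.derived D c hc : Filter ZFSet.{u}) := by
  constructor
  intro 𝒮 h𝒮 hmem
  rcases 𝒮.eq_empty_or_nonempty with rfl | hne
  · simp
  obtain ⟨X, rfl⟩ := h𝒮.exists_eq_range hne
  let s : ZFSet.{u} := (Ordinal.omega0.toZFSet.prod D).sep fun z =>
    ∃ n : ℕ, ∃ x ∈ X n, z = pair (n : Ordinal.{u}).toZFSet x
  have hs : ∀ (n : ℕ) x, pair (n : Ordinal.{u}).toZFSet x ∈ s ↔ x ∈ D ∧ x ∈ X n := by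
    intro n x
    simp only [s, mem_sep, pair_mem_prod, pair_inj, toZFSet_mem_toZFSet_iff]
    constructor
    · rintro ⟨⟨_, h⟩, m, y, hy, h', rfl⟩
      rw [toZFSet_injective.eq_iff, Nat.cast_inj] at h'
      exact ⟨h, h' ▸ hy⟩
    · rintro ⟨h, h'⟩
      exact ⟨⟨natCast_lt_omega0 n, h⟩, n, x, h', rfl, rfl⟩
  have key := eventually_derived_iff hc (P := fun S _ (v : Fin 2 → S) x =>
      ∀ n, SMem n (v 0) → ∃ z, SMem z (v 1) ∧ SPair z n x) (by
    repeat' first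
      | exact FO.mem _ _ | exact FO.pair _ _ _ | apply FO.ex | apply FO.all | apply FO.and
      | apply FO.imp) ![Ordinal.omega0.toZFSet, s]
  have h2 : ∀ᶠ x in j.derived D c hc, ∀ n, SMem n Ordinal.omega0.toZFSet →
      ∃ z, SMem z s ∧ SPair z n x := by
    refine key.2 fun n hn => ?_
    obtain ⟨a, ha, han⟩ := mem_toZFSet_iff.1 (j.mem_omega_of_mem_app hn)
    obtain ⟨n', rfl⟩ := lt_omega0.1 ha
    have hX : ∀ᶠ x in j.derived D c hc, x ∈ X n' := hmem _ ⟨n', rfl⟩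
    have := (eventually_derived_iff hc (P := fun S _ (v : Fin 2 → S) x =>
        ∃ z, SMem z (v 1) ∧ SPair z (v 0) x) (by
      repeat' first
        | exact FO.mem _ _ | exact FO.pair _ _ _ | apply FO.ex | apply FO.and)
        ![(n' : Ordinal.{u}).toZFSet, s]).1 (by
      filter_upwards [hX, eventually_mem_derived hc] with x hx hxD
      exact ⟨_, (hs n' x).2 ⟨hxD, hx⟩, spair_zfset.2 rfl⟩)
    obtain ⟨z, hz, hzp⟩ := this
    refine ⟨z, hz, j.spair_iff.2 ?_⟩
    rw [j.spair_iff] at hzp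
    rw [hzp]
    exact congrArg (pair · c) ((j.app_natCast n').trans han)
  filter_upwards [h2] with x hx
  rintro _ ⟨n, rfl⟩
  obtain ⟨z, hz, hzp⟩ := hx (n : Ordinal.{u}).toZFSet
    (toZFSet_mem_toZFSet_iff.2 (natCast_lt_omega0 n))
  rw [spair_zfset] at hzp
  subst hzp
  exact ((hs n x).1 hz).2

theorem eventually_mem_derived_iff {X : ZFSet.{u}} :
    (∀ᶠ x in j.derived D c hc, x ∈ X) ↔ c ∈ j.app X :=
  eventually_derived_iff hc (P := fun S _ (v : Unit → S) x => SMem x (v ())) (FO.mem _ _)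
    fun _ => X

theorem eventually_eq_derived {x : ZFSet.{u}} (h : j.app x = c) :
    ∀ᶠ y in j.derived D c hc, y = x :=
  (eventually_derived_iff hc (P := fun S _ (v : Unit → S) x => x = v ()) (FO.eq _ _)
    fun _ => x).2 (Subtype.ext h.symm)

theorem eventually_funLt_derived {K : ZFSet.{u}} (h : FunLt c (j.app K)) :
    ∀ᶠ x in j.derived D c hc, FunLt x K := by
  have := (eventually_derived_iff hc (P := fun S _ (v : Unit → S) x => SFunLt x (v ())) (by
    unfold SFunLt
    repeat' first
      | exact FO.mem _ _ | exact FO.pair _ _ _ | exact FO.eq _ _ | apply FO.ex | apply FO.all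
      | apply FO.and | apply FO.imp) fun _ => K).2 (j.sfunLt h)
  simpa only [sfunLt_iff] using this

end Derived

/-- The value of the function `j(t ↾ D)` at `c` is `a`. -/
def Codes (D : ZFSet.{u}) (t : ZFSet.{u} → ZFSet.{u}) (c a : ZFSet.{u}) : Prop :=
  pair c a ∈ j.app (graph D t)

section Codes

variable {j} {D c : ZFSet.{u}} (hc : c ∈ j.app D) {t s : ZFSet.{u} → ZFSet.{u}} {a b : ZFSet.{u}}

theorem Codes.mem (h : j.Codes D t c a) : a ∈ j.M := by
  have h1 := j.mem_of_mem_app h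
  have h2 : ({c, a} : ZFSet) ∈ pair c a := by simp [pair]
  exact j.transitive _ (j.transitive _ h1 _ h2) _ (by simp)

include hc in
-- The function `t` need not be definable: it is enough that `P` forces its value on `D`. This suits
-- `fst`, `snd` and `valueAt`, whose values off the intended arguments are arbitrary.
theorem Codes.of_sep {ι : Type}
    {P : ∀ (S : Type (u + 1)) [setLang.Structure S], (ι → S) → S → S → Prop}
    (hP : FO fun S _ (w : (ι ⊕ Unit) ⊕ Unit → S) =>
      P S (w ∘ Sum.inl ∘ Sum.inl) (w (Sum.inl (Sum.inr ()))) (w (Sum.inr ())))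
    (q : ι → ZFSet.{u}) (ha : a ∈ j.M)
    (h : P j.M (j.toM ∘ q) ⟨c, j.mem_of_mem_app hc⟩ ⟨a, ha⟩)
    (ht : ∀ x ∈ D, ∀ y, P ZFSet q x y → t x = y) : j.Codes D t c a := by
  have := (eventually_derived_iff hc (P := fun S _ (v : ι ⊕ Unit → S) x =>
      ∀ y, P S (v ∘ Sum.inl) x y → ∃ z, SMem z (v (Sum.inr ())) ∧ SPair z x y) (by
    refine FO.all (FO.imp ?_ ?_)
    · exact hP.comp (fun i : (ι ⊕ Unit) ⊕ Unit => match i with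
        | .inl (.inl i) => (Sum.inl (Sum.inl (Sum.inl i)) : (((ι ⊕ Unit) ⊕ Unit) ⊕ Unit))
        | .inl (.inr _) => .inl (.inr ())
        | .inr _ => .inr ())
    · repeat' first
        | exact FO.mem _ _ | exact FO.pair _ _ _ | apply FO.ex | apply FO.and)
      (Sum.elim q fun _ => graph D t)).1 (by
    filter_upwards [eventually_mem_derived hc] with x hx y hy
    exact ⟨_, pair_mem_graph.2 ⟨hx, ht x hx y hy⟩, spair_zfset.2 rfl⟩)
  obtain ⟨z, hz, hzp⟩ := this ⟨a, ha⟩ h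
  rw [j.spair_iff] at hzp
  change z.1 ∈ j.app (graph D t) at hz
  rwa [hzp] at hz

include hc in
theorem exists_codes (t : ZFSet.{u} → ZFSet.{u}) : ∃ a, j.Codes D t c a := by
  have := (eventually_derived_iff hc (P := fun S _ (v : Unit → S) x =>
      ∃ y, ∃ z, SMem z (v ()) ∧ SPair z x y) (by
    repeat' first
      | exact FO.mem _ _ | exact FO.pair _ _ _ | apply FO.ex | apply FO.and)
      fun _ => graph D t).1 (by
    filter_upwards [eventually_mem_derived hc] with x hx
    exact ⟨_, _, pair_mem_graph.2 ⟨hx, rfl⟩, spair_zfset.2 rfl⟩)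
  obtain ⟨y, z, hz, hzp⟩ := this
  rw [j.spair_iff] at hzp
  change z.1 ∈ j.app (graph D t) at hz
  exact ⟨y, by rwa [hzp] at hz⟩

/-- Łoś's theorem in its factored form: `[t] ↦ j(t)(c)` embeds the ultrapower by the derived
ultrafilter elementarily into `M`. -/
theorem Codes.realize_iff (ha : j.Codes D t c a) (hb : j.Codes D s c b) {ι : Type}
    {P : ∀ (S : Type (u + 1)) [setLang.Structure S], (ι → S) → S → S → Prop}
    (hP : FO fun S _ (w : (ι ⊕ Unit) ⊕ Unit → S) =>
      P S (w ∘ Sum.inl ∘ Sum.inl) (w (Sum.inl (Sum.inr ()))) (w (Sum.inr ())))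
    (q : ι → ZFSet.{u}) :
    (∀ᶠ x in j.derived D c hc, P ZFSet q (t x) (s x)) ↔
      P j.M (j.toM ∘ q) ⟨a, ha.mem⟩ ⟨b, hb.mem⟩ := by
  constructor
  · intro h
    refine (eventually_derived_iff hc (P := fun S _ (v : ι ⊕ Bool → S) x =>
        ∀ y y' z z', SMem z (v (Sum.inr true)) → SMem z' (v (Sum.inr false)) → SPair z x y →
          SPair z' x y' → P S (v ∘ Sum.inl) y y') (by
      refine FO.all (FO.all (FO.all (FO.all (FO.imp (FO.mem _ _) (FO.imp (FO.mem _ _)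
        (FO.imp (FO.pair _ _ _) (FO.imp (FO.pair _ _ _) ?_)))))))
      exact hP.comp (fun i : (ι ⊕ Unit) ⊕ Unit => match i with
        | .inl (.inl i) => (.inl (.inl (.inl (.inl (.inl (.inl i))))) :
            (((((ι ⊕ Bool) ⊕ Unit) ⊕ Unit) ⊕ Unit) ⊕ Unit) ⊕ Unit)
        | .inl (.inr _) => .inl (.inl (.inl (.inr ())))
        | .inr _ => .inl (.inl (.inr ()))))
      (Sum.elim q fun b => if b then graph D t else graph D s)).1 ?_ _ _
        ⟨pair c a, j.mem_of_mem_app ha⟩ ⟨pair c b, j.mem_of_mem_app hb⟩ ha hb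
        (j.spair_iff.2 rfl) (j.spair_iff.2 rfl)
    filter_upwards [h] with x hx y y' z z' hz hz' hy hy'
    rw [spair_zfset] at hy hy'
    subst hy hy'
    obtain ⟨-, rfl⟩ := pair_mem_graph.1 hz
    obtain ⟨-, rfl⟩ := pair_mem_graph.1 hz'
    exact hx
  · intro h
    have := (eventually_derived_iff hc (P := fun S _ (v : ι ⊕ Bool → S) x =>
        ∃ y y' z z', SMem z (v (Sum.inr true)) ∧ SMem z' (v (Sum.inr false)) ∧ SPair z x y ∧
          SPair z' x y' ∧ P S (v ∘ Sum.inl) y y') (by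
      refine FO.ex (FO.ex (FO.ex (FO.ex (FO.and (FO.mem _ _) (FO.and (FO.mem _ _)
        (FO.and (FO.pair _ _ _) (FO.and (FO.pair _ _ _) ?_)))))))
      exact hP.comp (fun i : (ι ⊕ Unit) ⊕ Unit => match i with
        | .inl (.inl i) => (.inl (.inl (.inl (.inl (.inl (.inl i))))) :
            (((((ι ⊕ Bool) ⊕ Unit) ⊕ Unit) ⊕ Unit) ⊕ Unit) ⊕ Unit)
        | .inl (.inr _) => .inl (.inl (.inl (.inr ())))
        | .inr _ => .inl (.inl (.inr ()))))
      (Sum.elim q fun b => if b then graph D t else graph D s)).2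
        ⟨_, _, ⟨pair c a, j.mem_of_mem_app ha⟩, ⟨pair c b, j.mem_of_mem_app hb⟩, ha, hb,
        j.spair_iff.2 rfl, j.spair_iff.2 rfl, h⟩
    filter_upwards [this] with x ⟨y, y', z, z', hz, hz', hy, hy', hx⟩
    rw [spair_zfset] at hy hy'
    subst hy hy'
    obtain ⟨-, rfl⟩ := pair_mem_graph.1 hz
    obtain ⟨-, rfl⟩ := pair_mem_graph.1 hz'
    exact hx

theorem Codes.mem_iff (ha : j.Codes D t c a) (hb : j.Codes D s c b) :
    (∀ᶠ x in j.derived D c hc, t x ∈ s x) ↔ a ∈ b :=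
  ha.realize_iff hc hb (P := fun _ _ (_ : Empty → _) x y => SMem x y) (FO.mem _ _) Empty.elim

theorem Codes.eq_iff (ha : j.Codes D t c a) (hb : j.Codes D s c b) :
    (∀ᶠ x in j.derived D c hc, t x = s x) ↔ a = b :=
  (ha.realize_iff hc hb (P := fun _ _ (_ : Empty → _) x y => x = y) (FO.eq _ _) Empty.elim).trans
    (by simp)

include hc in
theorem Codes.unique (ha : j.Codes D t c a) (hb : j.Codes D t c b) : a = b :=
  (ha.eq_iff hc hb).1 (.of_forall fun _ => rfl)

theorem Codes.mem_app_iff (ha : j.Codes D t c a) {X : ZFSet.{u}} :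
    (∀ᶠ x in j.derived D c hc, t x ∈ X) ↔ a ∈ j.app X :=
  ha.realize_iff hc ha (P := fun _ _ (v : Unit → _) x _ => SMem x (v ())) (FO.mem _ _) fun _ => X

/-- If `a = j(t)(c)`, the ultrafilter of `a` is the image under `t` of that of `c`. -/
theorem Codes.eventually_iff (h : j.Codes D t c a) (ha : a ∈ j.app D) {P : ZFSet.{u} → Prop} :
    (∀ᶠ x in j.derived D a ha, P x) ↔ ∀ᶠ x in j.derived D c hc, P (t x) := by
  rw [eventually_derived, ← h.mem_app_iff hc]
  simp only [mem_sep, eventually_and, (h.mem_app_iff hc).2 ha, true_and]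

include hc in
theorem Codes.comp (h : j.Codes D t c a) (ha : a ∈ j.app D) (h' : j.Codes D s a b) :
    j.Codes D (fun x => s (t x)) c b := by
  obtain ⟨b', hb'⟩ := exists_codes hc (fun x => s (t x))
  have := (h.realize_iff hc hb' (P := fun S _ (v : Unit → S) y y' =>
      ∃ z, SMem z (v ()) ∧ SPair z y y') (by
    repeat' first
      | exact FO.mem _ _ | exact FO.pair _ _ _ | apply FO.ex | apply FO.and)
    fun _ => graph D s).1 (by
    filter_upwards [(h.mem_app_iff hc).2 ha] with x hx
    exact ⟨_, pair_mem_graph.2 ⟨hx, rfl⟩, spair_zfset.2 rfl⟩)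
  obtain ⟨z, hz, hzp⟩ := this
  rw [j.spair_iff] at hzp
  change z.1 ∈ j.app (graph D s) at hz
  rw [hzp] at hz
  rwa [Codes.unique ha h' hz]

theorem codes_fst (h : pair a b ∈ j.app D) (ha : a ∈ j.M) (hb : b ∈ j.M) :
    j.Codes D fst (pair a b) a :=
  Codes.of_sep h (P := fun _ _ (_ : Empty → _) x y => ∃ z, SPair x y z) (by
    repeat' first | exact FO.pair _ _ _ | apply FO.ex) Empty.elim
    ha ⟨⟨b, hb⟩, j.spair_iff.2 rfl⟩ fun x _ y ⟨z, hz⟩ => by simp [spair_zfset.1 hz]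

theorem codes_snd (h : pair a b ∈ j.app D) (ha : a ∈ j.M) (hb : b ∈ j.M) :
    j.Codes D snd (pair a b) b :=
  Codes.of_sep h (P := fun _ _ (_ : Empty → _) x y => ∃ z, SPair x z y) (by
    repeat' first | exact FO.pair _ _ _ | apply FO.ex) Empty.elim
    hb ⟨⟨a, ha⟩, j.spair_iff.2 rfl⟩ fun x _ y ⟨z, hz⟩ => by simp [spair_zfset.1 hz]

theorem codes_valueAt {x : ZFSet.{u}} (hx : j.app x = x) (hc : c ∈ j.app D)
    (h : pair x a ∈ c) (h' : ∀ y, pair x y ∈ c → y = a) (ha : a ∈ j.M) :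
    j.Codes D (valueAt x) c a := by
  have hcM := j.mem_of_mem_app hc
  refine Codes.of_sep hc (P := fun _ _ (v : Unit → _) z y =>
    (∃ w, SMem w z ∧ SPair w (v ()) y) ∧ ∀ y' w, SMem w z → SPair w (v ()) y' → y' = y) (by
    repeat' first
      | exact FO.mem _ _ | exact FO.pair _ _ _ | exact FO.eq _ _ | apply FO.ex | apply FO.all
      | apply FO.and | apply FO.imp) (fun _ => x) ha ?_ fun z _ y hy => ?_
  · refine ⟨⟨⟨_, j.transitive _ hcM _ h⟩, h, j.spair_iff.2 ?_⟩, fun y w hw hwp => ?_⟩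
    · exact congrArg (pair · a) hx.symm
    · rw [j.spair_iff] at hwp
      change w.1 = pair (j.app x) y at hwp
      rw [hx] at hwp
      exact Subtype.ext (h' y (hwp ▸ hw))
  · simp only [smem_zfset, spair_zfset] at hy
    obtain ⟨⟨_, hw, rfl⟩, h2⟩ := hy
    exact valueAt_eq hw fun y' hy' => h2 y' _ hy' rfl

theorem Codes.eventually_mem_range (ha : j.Codes D t c a) (hb : j.Codes D s c b) {x : ZFSet.{u}}
    (hx : x ∈ j.M) (hxa : pair x a ∈ b) :
    ∀ᶠ z in j.derived D c hc, ∃ y, pair y (t z) ∈ s z := by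
  have := (ha.realize_iff hc hb (P := fun _ _ (_ : Empty → _) y z =>
    ∃ x w, SMem w z ∧ SPair w x y) (by
    repeat' first
      | exact FO.mem _ _ | exact FO.pair _ _ _ | apply FO.ex | apply FO.and) Empty.elim).2
    ⟨⟨x, hx⟩, ⟨_, j.transitive _ hb.mem _ hxa⟩, hxa, j.spair_iff.2 rfl⟩
  filter_upwards [this] with z ⟨y, w, hw, hwp⟩
  exact ⟨y, spair_zfset.1 hwp ▸ hw⟩

end Codes

end Emb

/-! ### Cardinality inside a structure -/

/-- `|s| < θ` in the sense of a structure. -/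
def SCardLt {S : Type*} [setLang.Structure S] (s θ : S) : Prop :=
  ∃ α, SMem α θ ∧ ∃ f, (∀ w, SMem w f → ∃ x, SMem x s ∧ ∃ y, SMem y α ∧ SPair w x y) ∧
    (∀ x, SMem x s → ∃ y, (∃ w, SMem w f ∧ SPair w x y) ∧
      ∀ y', (∃ w, SMem w f ∧ SPair w x y') → y' = y) ∧
    ∀ y, SMem y α → ∃ x, (∃ w, SMem w f ∧ SPair w x y) ∧
      ∀ x', (∃ w, SMem w f ∧ SPair w x' y) → x' = x

theorem FO.cardLt {ι : Type} (i k : ι) :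
    FO.{u} fun S _ (v : ι → S) => SCardLt (v i) (v k) := by
  unfold SCardLt
  repeat' first
    | exact FO.mem _ _ | exact FO.pair _ _ _ | exact FO.eq _ _ | apply FO.ex | apply FO.all
    | apply FO.and | apply FO.imp

theorem scardLt_of_card_lt {s : ZFSet.{u}} {κ : Cardinal.{u}} (h : s.card < κ) :
    SCardLt s κ.ord.toZFSet := by
  have hc : Cardinal.mk s = Cardinal.mk s.card.ord.toZFSet := by
    rw [cardinalMk_coe_sort, cardinalMk_coe_sort, card_toZFSet, Cardinal.card_ord]
  obtain ⟨g⟩ := Cardinal.eq.1 hc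
  let f : ZFSet.{u} := ZFSet.range fun x : s => pair x.1 (g x).1
  have hf : ∀ x y, pair x y ∈ f ↔ ∃ hx : x ∈ s, (g ⟨x, hx⟩).1 = y := by
    intro x y
    simp only [f, mem_range, pair_inj]
    constructor
    · rintro ⟨⟨z, hz⟩, rfl, rfl⟩
      exact ⟨hz, rfl⟩
    · rintro ⟨hx, rfl⟩
      exact ⟨⟨x, hx⟩, rfl, rfl⟩
  simp only [SCardLt, smem_zfset, spair_zfset, exists_eq_right]
  refine ⟨_, toZFSet_mem_toZFSet_iff.2 (Cardinal.ord_lt_ord.2 h), f, fun w hw => ?_, fun x hx => ?_,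
    fun y hy => ?_⟩
  · obtain ⟨x, rfl⟩ := mem_range.1 hw
    exact ⟨x.1, x.2, _, (g x).2, rfl⟩
  · refine ⟨_, (hf _ _).2 ⟨hx, rfl⟩, fun y' hy' => ?_⟩
    obtain ⟨_, rfl⟩ := (hf _ _).1 hy'
    rfl
  · refine ⟨(g.symm ⟨y, hy⟩).1, (hf _ _).2 ⟨(g.symm ⟨y, hy⟩).2, by simp⟩, fun x' hx' => ?_⟩
    obtain ⟨hx, h'⟩ := (hf _ _).1 hx'
    have : g ⟨x', hx⟩ = ⟨y, hy⟩ := Subtype.ext h'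
    rw [← this]
    simp

theorem Emb.cardLtIn (j : Emb.{u}) {s θ : j.M} (h : SCardLt s θ) : CardLtIn j.M s θ := by
  simp only [SCardLt, j.smem_iff, j.spair_iff] at h
  obtain ⟨α, hα, f, h1, h2, h3⟩ := h
  have hp : ∀ {x y : ZFSet.{u}}, pair x y ∈ f.1 → x ∈ j.M ∧ y ∈ j.M := by
    intro x y hxy
    obtain ⟨x', hx', y', hy', hw⟩ := h1 ⟨_, j.transitive _ f.2 _ hxy⟩ hxy
    obtain ⟨rfl, rfl⟩ := pair_inj.1 hw
    exact ⟨x'.2, y'.2⟩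
  refine ⟨α, hα, f, f.2, ⟨fun w hw => ?_, fun x hx => ?_⟩, fun y hy => ?_⟩
  · obtain ⟨x, hx, y, hy, hw⟩ := h1 ⟨_, j.transitive _ f.2 _ hw⟩ hw
    exact mem_prod.2 ⟨x, hx, y, hy, hw⟩
  · obtain ⟨y, ⟨w, hw, hwp⟩, hu⟩ := h2 ⟨x, j.transitive _ s.2 _ hx⟩ hx
    refine ⟨y, by simpa [← hwp] using hw, fun y' hy' => ?_⟩
    exact congrArg Subtype.val (hu ⟨y', (hp hy').2⟩ ⟨⟨_, j.transitive _ f.2 _ hy'⟩, hy', rfl⟩)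
  · obtain ⟨x, ⟨w, hw, hwp⟩, hu⟩ := h3 ⟨y, j.transitive _ α.2 _ hy⟩ hy
    refine ⟨x, by simpa [← hwp] using hw, fun x' hx' => ?_⟩
    exact congrArg Subtype.val (hu ⟨x', (hp hx').1⟩ ⟨⟨_, j.transitive _ f.2 _ hx'⟩, hx', rfl⟩)

/-! ### Mostowski collapse -/

section Collapse

variable {S : Type (u + 1)} [setLang.Structure S]

theorem smem_ext (i : ZFSet.{u} ↪ₑ[setLang] S) {x y : S} (h : ∀ z, SMem z x ↔ SMem z y) :
    x = y := by
  have := (FO.realize_iff (P := fun S _ (_ : Empty → S) =>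
    ∀ x y : S, (∀ z, SMem z x ↔ SMem z y) → x = y) (by
      repeat' first
        | exact FO.mem _ _ | exact FO.eq _ _ | apply FO.all | apply FO.imp | apply FO.iff)
      i Empty.elim).2 fun x y h => ZFSet.ext h
  exact this x y h

/-- **Mostowski collapse** of an elementary extension of the universe. -/
theorem exists_collapse (i : ZFSet.{u} ↪ₑ[setLang] S) (wf : WellFounded (SMem : S → S → Prop))
    (hsmall : ∀ x : S, Small.{u} {y // SMem y x}) :
    ∃ (e : Emb.{u}) (π : S ≃[setLang] e.M), (∀ x y, (π x).1 ∈ (π y).1 ↔ SMem x y) ∧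
      ∀ z, e.toM z = π (i z) := by
  let π : S → ZFSet.{u} := wf.fix fun x ih =>
    ZFSet.range fun y : {y // SMem y x} => ih y.1 y.2
  have hπ : ∀ x, π x = ZFSet.range fun y : {y // SMem y x} => π y.1 := fun x => wf.fix_eq _ x
  have hmem : ∀ x z, z ∈ π x ↔ ∃ y, SMem y x ∧ π y = z := by
    intro x z
    rw [hπ, mem_range]
    exact ⟨fun ⟨⟨y, hy⟩, h⟩ => ⟨y, hy, h⟩, fun ⟨y, hy, h⟩ => ⟨⟨y, hy⟩, h⟩⟩
  have hinj : ∀ x y, π x = π y → x = y := by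
    intro x
    induction x using wf.induction with
    | _ x ih =>
      intro y hxy
      refine smem_ext i fun z => ⟨fun hz => ?_, fun hz => ?_⟩
      · obtain ⟨w, hw, hwz⟩ := (hmem y _).1 (hxy ▸ (hmem x (π z)).2 ⟨z, hz, rfl⟩)
        rwa [ih z hz w hwz.symm]
      · obtain ⟨w, hw, hwz⟩ := (hmem x _).1 (hxy ▸ (hmem y (π z)).2 ⟨z, hz, rfl⟩)
        rwa [← ih w hw z hwz]
  have hmem' : ∀ x y, π x ∈ π y ↔ SMem x y := by
    intro x y
    rw [hmem]
    refine ⟨fun ⟨z, hz, h⟩ => ?_, fun h => ⟨x, h, rfl⟩⟩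
    rwa [← hinj _ _ h]
  let eq : S ≃ Set.range π := Equiv.ofInjective π fun x y => hinj x y
  let E : S ≃[setLang] Set.range π :=
    { eq with
      map_fun' := fun f => Empty.elim f
      map_rel' := by
        rintro n (_ | _) x
        have h2 : (Language.Structure.RelMap memSymb x : Prop) ↔ SMem (x 0) (x 1) := by
          rw [SMem]
          congr!
          ext k
          fin_cases k <;> rfl
        exact (hmem' (x 0) (x 1)).trans h2.symm }
  refine ⟨⟨Set.range π, ?_, E.toElementaryEmbedding.comp i⟩, E, hmem', fun z => rfl⟩
  rintro _ ⟨x, rfl⟩ z hz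
  obtain ⟨y, -, rfl⟩ := (hmem x z).1 hz
  exact ⟨y, rfl⟩

end Collapse

/-! ### Fine ultrafilters from supercompactness -/

section Supercompact

/-- The index set of the ultrafilters derived from supercompactness embeddings. -/
noncomputable def relIndex (δ : Ordinal.{u}) : ZFSet.{u} := powerset (prod δ.toZFSet δ.toZFSet)

theorem Emb.mem_app_relIndex (j : Emb.{u}) {δ : Ordinal.{u}} {f : ZFSet.{u}} (hf : f ∈ j.M)
    (h : ∀ z ∈ f, ∃ a ∈ j.app δ.toZFSet, ∃ b ∈ j.app δ.toZFSet, z = pair a b) :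
    f ∈ j.app (relIndex δ) := by
  have := (j.transfer (P := fun S _ (v : Fin 2 → S) => ∀ x, (∀ z, SMem z x → ∃ a, SMem a (v 0) ∧
      ∃ b, SMem b (v 0) ∧ SPair z a b) → SMem x (v 1)) (by
    repeat' first
      | exact FO.mem _ _ | exact FO.pair _ _ _ | apply FO.ex | apply FO.all | apply FO.and
      | apply FO.imp) ![δ.toZFSet, relIndex δ]).2 (by
    intro x hx
    change x ∈ relIndex δ
    rw [relIndex, mem_powerset]
    refine fun z hz => mem_prod.2 ?_
    obtain ⟨a, ha, b, hb, hab⟩ := hx z hz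
    exact ⟨a, ha, b, hb, spair_zfset.1 hab⟩)
  refine this ⟨f, hf⟩ fun z hz => ?_
  obtain ⟨a, ha, b, hb, hab⟩ := h z hz
  exact ⟨⟨a, j.mem_of_mem_app ha⟩, ha, ⟨b, j.mem_of_mem_app hb⟩, hb, j.spair_iff.2 hab⟩

/-- A `μ`-complete ultrafilter on sets of pairs whose range is almost surely of size `< μ` and
contains any given ordinal below `l`. -/
structure IsFineUltrafilter (δ l : Ordinal.{u}) (μ : Cardinal.{u}) (U : Ultrafilter ZFSet.{u}) :
    Prop where
  mem_relIndex : ∀ᶠ g in U, g ∈ relIndex δ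
  countable : CountableInterFilter (U : Filter ZFSet.{u})
  fine : ∀ ξ < l, ∀ᶠ g : ZFSet.{u} in U, ∃ s, pair s ξ.toZFSet ∈ g
  funLt : ∀ᶠ g in U, FunLt g μ.ord.toZFSet
  complete : ∀ γ < μ.ord, ∀ t : ZFSet.{u} → ZFSet.{u}, (∀ᶠ g in U, t g ∈ γ.toZFSet) →
    ∃ β < γ, ∀ᶠ g in U, t g = β.toZFSet

/-- The seed is `f = k ↾ l`, which lies in the target class by closure under `l`-sequences. Its
domain is `l < k(μ)`, whence `funLt`; its range contains `k(ξ)` for each `ξ < l`, whence `fine`;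
completeness holds because `k` fixes the ordinals below `μ`. -/
theorem IsSupercompact.exists_isFineUltrafilter {δ l : Ordinal.{u}} {μ : Cardinal.{u}}
    (h : IsSupercompact μ l) (hμ : μ.ord < δ) (hl : l < δ) :
    ∃ U, IsFineUltrafilter δ l μ U := by
  obtain ⟨k, ⟨⟨-, hcrit⟩, hlk⟩, hclosed⟩ := h
  let f : ZFSet.{u} := ZFSet.range fun x : l.toZFSet => pair x.1 (k.app x.1)
  have hf : ∀ {x y}, pair x y ∈ f ↔ x ∈ l.toZFSet ∧ k.app x = y := pair_mem_graph
  have hfz : ∀ z ∈ f, ∃ x ∈ l.toZFSet, z = pair x (k.app x) := by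
    intro z hz
    obtain ⟨x, rfl⟩ := mem_range.1 hz
    exact ⟨x.1, x.2, rfl⟩
  have hfM : f ∈ k.M := by
    refine hclosed f (ZFSet.range fun x : l.toZFSet => k.app x.1) ⟨fun z hz => ?_, fun x hx => ?_⟩ ?_
    · obtain ⟨x, hx, rfl⟩ := hfz z hz
      exact pair_mem_prod.2 ⟨hx, mem_range.2 ⟨⟨x, hx⟩, rfl⟩⟩
    · exact ⟨_, hf.2 ⟨hx, rfl⟩, fun y hy => (hf.1 hy).2.symm⟩
    · intro z hz
      obtain ⟨x, rfl⟩ := mem_range.1 hz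
      exact k.app_mem _
  have hδ : (k.app δ.toZFSet).IsTransitive := k.isTransitive_app (isOrdinal_toZFSet δ).isTransitive
  have hlδ : l.toZFSet ∈ k.app δ.toZFSet :=
    hδ _ (k.app_mem_app.2 (toZFSet_mem_toZFSet_iff.2 hμ)) hlk
  have hc : f ∈ k.app (relIndex δ) := by
    refine k.mem_app_relIndex hfM fun z hz => ?_
    obtain ⟨x, hx, rfl⟩ := hfz z hz
    refine ⟨x, hδ _ hlδ hx, _, ?_, rfl⟩
    exact k.app_mem_app.2 ((isOrdinal_toZFSet δ).mem_trans hx (toZFSet_mem_toZFSet_iff.2 hl))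
  refine ⟨k.derived _ f hc, Emb.eventually_mem_derived hc, inferInstance, fun ξ hξ => ?_, ?_,
    fun γ hγ t ht => ?_⟩
  · have hξ' := toZFSet_mem_toZFSet_iff.2 hξ
    have := (Emb.eventually_derived_iff hc (P := fun S _ (v : Unit → S) x =>
        ∃ s w, SMem w x ∧ SPair w s (v ())) (by
      repeat' first
        | exact FO.mem _ _ | exact FO.pair _ _ _ | apply FO.ex | apply FO.and)
      fun _ => ξ.toZFSet).2 ⟨⟨ξ.toZFSet, k.transitive _ (k.mem_of_mem_app hlk) _ hξ'⟩,
        ⟨_, k.transitive _ hfM _ (hf.2 ⟨hξ', rfl⟩)⟩, hf.2 ⟨hξ', rfl⟩, k.spair_iff.2 rfl⟩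
    simpa only [smem_zfset, spair_zfset, exists_eq_right] using this
  · refine Emb.eventually_funLt_derived hc ⟨⟨_, hlk, fun w hw => ?_⟩, fun s y y' hy hy' => ?_⟩
    · obtain ⟨x, hx, rfl⟩ := hfz w hw
      exact ⟨x, hx, _, rfl⟩
    · rw [← (hf.1 hy).2, ← (hf.1 hy').2]
  · obtain ⟨b, hb⟩ := Emb.exists_codes hc t
    have hbγ := (hb.mem_app_iff hc).1 ht
    rw [hcrit γ hγ] at hbγ
    obtain ⟨β, hβ, rfl⟩ := mem_toZFSet_iff.1 hbγ
    refine ⟨β, hβ, ?_⟩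
    have hs : ∀ᶠ x in k.derived _ f hc, t x ∈ ({β.toZFSet} : ZFSet) := by
      rw [hb.mem_app_iff hc, k.app_singleton, hcrit β (hβ.trans hγ)]
      simp
    simpa using hs

end Supercompact

/-! ### A joint distribution for all seeds -/

section Generic

variable {j : Emb.{u}} {D S : ZFSet.{u}}

/-- Pairing makes seeds directed: an iterated pair recovers each of its finitely many entries by
projections. -/
theorem Emb.exists_codes_finset (hS : S ⊆ j.app D) (hpair : ∀ a ∈ S, ∀ b ∈ S, pair a b ∈ S)
    (hne : S.Nonempty) (s : Finset S) :
    ∃ (c : S) (t : S → ZFSet.{u} → ZFSet.{u}), ∀ a ∈ s, j.Codes D (t a) c a := by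
  classical
  have hM : ∀ a : S, a.1 ∈ j.M := fun a => j.mem_of_mem_app (hS a.2)
  induction s using Finset.induction_on with
  | empty => exact ⟨⟨_, hne.some_mem⟩, fun _ => id, by simp⟩
  | insert a s _ ih =>
    obtain ⟨c, t, h⟩ := ih
    have hac := hpair a a.2 c c.2
    refine ⟨⟨_, hac⟩, fun b => if b = a then fst else fun x => t b (snd x), fun b hb => ?_⟩
    dsimp only
    split_ifs with hba
    · rw [hba]
      exact Emb.codes_fst (hS hac) (hM a) (hM c)
    · exact (Emb.codes_snd (hS hac) (hM a) (hM c)).comp (hS hac) (hS c.2)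
        (h b ((Finset.mem_insert.1 hb).resolve_left hba))

/-- The ultrafilters derived from all seeds in `S` are the marginals of one ultrafilter on
assignments. -/
theorem Emb.exists_generic (hS : S ⊆ j.app D) (hpair : ∀ a ∈ S, ∀ b ∈ S, pair a b ∈ S)
    (hne : S.Nonempty) :
    ∃ G : Ultrafilter (S → ZFSet.{u}),
      (∀ (c : S) (P : ZFSet.{u} → Prop),
        (∀ᶠ p : S → ZFSet.{u} in G, P (p c)) ↔ ∀ᶠ x in j.derived D c (hS c.2), P x) ∧
      ∀ (c a : S) (t : ZFSet.{u} → ZFSet.{u}), j.Codes D t c a →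
        ∀ᶠ p : S → ZFSet.{u} in G, p a = t (p c) := by
  classical
  -- `Q` is large when finitely many coordinates decide it: for any common code `c` of the seeds in
  -- `s`, almost every `x` puts into `Q` all assignments that take the coded values on `s`. A common
  -- code exists, so the filter is proper; any ultrafilter extending it will do.
  let 𝒢 : Filter (S → ZFSet.{u}) :=
    { sets := {Q | ∃ s : Finset S, ∀ (c : S) (t : S → ZFSet.{u} → ZFSet.{u}),
        (∀ a ∈ s, j.Codes D (t a) c a) →
          ∀ᶠ x in j.derived D c (hS c.2), ∀ p : S → ZFSet.{u}, (∀ a ∈ s, p a = t a x) → p ∈ Q}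
      univ_sets := ⟨∅, by simp⟩
      sets_of_superset := by
        rintro Q Q' ⟨s, h⟩ hQ
        refine ⟨s, fun c t ht => ?_⟩
        filter_upwards [h c t ht] with x hx p hp using hQ (hx p hp)
      inter_sets := by
        rintro Q Q' ⟨s, h⟩ ⟨s', h'⟩
        refine ⟨s ∪ s', fun c t ht => ?_⟩
        filter_upwards [h c t fun a ha => ht a (Finset.mem_union_left _ ha),
          h' c t fun a ha => ht a (Finset.mem_union_right _ ha)] with x hx hx' p hp
        exact ⟨hx p fun a ha => hp a (Finset.mem_union_left _ ha),
          hx' p fun a ha => hp a (Finset.mem_union_right _ ha)⟩ }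
  have hne' : 𝒢.NeBot := by
    refine Filter.neBot_iff.2 fun hbot => ?_
    have : ∅ ∈ 𝒢 := hbot ▸ Filter.mem_bot
    revert this
    rintro ⟨s, h⟩
    obtain ⟨c, t, ht⟩ := Emb.exists_codes_finset hS hpair hne s
    obtain ⟨x, hx⟩ := (h c t ht).exists
    exact hx (fun a => t a x) fun a _ => rfl
  have hle : ∀ {P : (S → ZFSet.{u}) → Prop}, (∀ᶠ p in 𝒢, P p) → ∀ᶠ p in Ultrafilter.of 𝒢, P p :=
    fun h => Ultrafilter.of_le 𝒢 h
  have h1 : ∀ (c : S) (P : ZFSet.{u} → Prop), (∀ᶠ x in j.derived D c (hS c.2), P x) →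
      ∀ᶠ p : S → ZFSet.{u} in Ultrafilter.of 𝒢, P (p c) := by
    refine fun c P hP => hle ⟨{c}, fun d t ht => ?_⟩
    have ht := ht c (Finset.mem_singleton_self c)
    filter_upwards [(ht.eventually_iff (hS d.2) (hS c.2)).1 hP] with x hx p hp
    rwa [hp c (Finset.mem_singleton_self c)]
  refine ⟨Ultrafilter.of 𝒢, fun c P => ⟨fun h => ?_, h1 c P⟩, fun c a t hc => hle ?_⟩
  · by_contra hn
    have := h1 c _ (Ultrafilter.eventually_not.2 hn)
    exact Ultrafilter.eventually_not.1 this h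
  · refine ⟨{c, a}, fun d r hr => ?_⟩
    have hrc := hr c (by simp)
    have hra := hr a (by simp)
    filter_upwards [((hrc.comp (hS d.2) (hS c.2) hc).eq_iff (hS d.2) hra).2 rfl] with x hx p hp
    rw [hp c (by simp), hp a (by simp), hx]

end Generic

/-! ### The two-step ultrapower and its elementary substructure -/

section Ultraproduct

variable {S : ZFSet.{u}}

/-- The elementary substructure of the ultrapower of the universe formed by the functions that
depend on one coordinate of the assignment. -/
theorem exists_seedUltrapower (G : Ultrafilter (S → ZFSet.{u}))
    (V : (S → ZFSet.{u}) → Ultrafilter ZFSet.{u})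
    (hdir : ∀ s : Finset S, ∃ (e : S) (t : S → ZFSet.{u} → ZFSet.{u}),
      ∀ c ∈ s, ∀ᶠ p : S → ZFSet.{u} in G, p c = t c (p e)) :
    ∃ (H : Type (u + 1)) (_ : setLang.Structure H)
      (mk : (ZFSet.{u} → ZFSet.{u} → ZFSet.{u}) → S → H),
      (∀ x, ∃ f c, x = mk f c) ∧
      ∀ {ι : Type} {P : ∀ (S : Type (u + 1)) [setLang.Structure S], (ι → S) → Prop}, FO P →
        ∀ (f : ι → ZFSet.{u} → ZFSet.{u} → ZFSet.{u}) (c : ι → S),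
          P H (fun k => mk (f k) (c k)) ↔
            ∀ᶠ p : S → ZFSet.{u} in G, ∀ᶠ g : ZFSet.{u} in V p, P ZFSet fun k => f k (p (c k)) g := by
  classical
  -- The iteration as one ultrafilter: first an assignment `p`, then a point `g` drawn from `V p`.
  let F : Ultrafilter ((S → ZFSet.{u}) × ZFSet.{u}) := G.bind fun p => (V p).map (Prod.mk p)
  have hF : ∀ P : (S → ZFSet.{u}) × ZFSet.{u} → Prop,
      (∀ᶠ z in F, P z) ↔ ∀ᶠ p : S → ZFSet.{u} in G, ∀ᶠ g : ZFSet.{u} in V p, P (p, g) :=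
    fun P => Iff.rfl
  let N := (F : Filter ((S → ZFSet.{u}) × ZFSet.{u})).Product fun _ => ZFSet.{u}
  let cls : (ZFSet.{u} → ZFSet.{u} → ZFSet.{u}) → S → N := fun f c =>
    ((fun z => f (z.1 c) z.2 : (S → ZFSet.{u}) × ZFSet.{u} → ZFSet.{u}) : N)
  let H : setLang.Substructure N :=
    { carrier := {x | ∃ f c, x = cls f c}
      fun_mem := fun f => Empty.elim f }
  have hH : H.IsElementary := by
    -- Tarski–Vaught test: the finitely many parameters all depend on one seed `e`, so a pointwise
    -- choice of witness is again a function of `p e` and `g`.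
    refine H.isElementary_of_exists fun n φ x a hφ => ?_
    choose f c hfc using fun k => (x k).2
    obtain ⟨e, t, ht⟩ := hdir (Finset.univ.image c)
    have ht : ∀ k, ∀ᶠ p : S → ZFSet.{u} in G, p (c k) = t (c k) (p e) := fun k => ht _ (by simp)
    induction a using Quotient.inductionOn with | _ α => ?_
    let h : ZFSet.{u} → ZFSet.{u} → ZFSet.{u} := fun y g => Classical.epsilon fun b =>
      φ.Realize (Empty.elim : Empty → ZFSet.{u}) (Fin.snoc (fun k => f k (t (c k) y) g) b)
    refine ⟨⟨cls h e, h, e, rfl⟩, ?_⟩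
    have key : ∀ (v : Empty → N) (β : (S → ZFSet.{u}) × ZFSet.{u} → ZFSet.{u}),
        φ.Realize v (Fin.snoc ((↑) ∘ x) (β : N)) ↔
        ∀ᶠ z in F, φ.Realize (Empty.elim : Empty → ZFSet.{u})
          (Fin.snoc (fun k => f k (z.1 (c k)) z.2) (β z)) := by
      intro v β
      have := Language.Ultraproduct.boundedFormula_realize_cast (u := F) φ
        (fun e : Empty => e.elim)
        (Fin.snoc (fun k z => f k (z.1 (c k)) z.2) β : Fin (n + 1) → _ → ZFSet.{u})
      rw [Subsingleton.elim v _]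
      refine Iff.trans (iff_of_eq (congrArg _ (funext ?_))) (this.trans ?_)
      · refine Fin.lastCases ?_ fun k => ?_
        · rw [Fin.snoc_last]
          exact Fin.snoc_last (α := fun _ => N) _ _
        · rw [Fin.snoc_castSucc]
          exact (Fin.snoc_castSucc (α := fun _ => N) _ _ _).trans (hfc k)
      · refine iff_of_eq (congrArg (Filter.Eventually · _) (funext fun z => congrArg₂ _
          (Subsingleton.elim _ _) (funext ?_)))
        refine Fin.lastCases ?_ fun k => ?_
        · simp
        · simp
    refine (key _ _).2 ?_
    have h1 := (key _ α).1 hφ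
    rw [hF] at h1 ⊢
    filter_upwards [h1, eventually_all.2 ht] with p hp hpt
    filter_upwards [hp] with g hg
    simp only [hpt] at hg ⊢
    exact Classical.epsilon_spec (p := fun b => φ.Realize (Empty.elim : Empty → ZFSet.{u})
      (Fin.snoc (fun k => f k (t (c k) (p e)) g) b)) ⟨_, hg⟩
  refine ⟨H, inferInstance, fun f c => ⟨cls f c, f, c, rfl⟩, fun ⟨x, f, c, hx⟩ => ⟨f, c, ?_⟩, ?_⟩
  · exact Subtype.ext hx
  · rintro ι P ⟨φ, hφ⟩ f c
    let e : H ↪ₑ[setLang] N := (⟨H, hH⟩ : setLang.ElementarySubstructure N).subtype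
    have h1 := e.map_formula φ fun k => (⟨cls (f k) (c k), f k, c k, rfl⟩ : H)
    simp only [← hφ]
    rw [← h1]
    exact Language.Ultraproduct.realize_formula_cast (u := F) φ fun k z => f k (z.1 (c k)) z.2

end Ultraproduct

/-! ### Seed data and the model built from it -/

/-- The data from which an elementary embedding is built: an embedding `j`, a set `S` of seeds that
is closed under pairs and `l`-sequences, and a seed `m` at which fine ultrafilters are attached. -/
structure SeedData (δ l : Ordinal.{u}) (κ : Cardinal.{u}) where
  j : Emb.{u}
  D : ZFSet.{u}
  S : ZFSet.{u}
  m : ZFSet.{u}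
  B : ZFSet.{u}
  subset_app : S ⊆ j.app D
  pair_mem : ∀ a ∈ S, ∀ b ∈ S, pair a b ∈ S
  seq_mem : ∀ a : l.toZFSet → S, ZFSet.range (fun x : l.toZFSet => pair x.1 (a x).1) ∈ S
  isCrit : j.IsCrit κ.ord
  le : κ.ord ≤ l
  omega_le : Ordinal.omega0 ≤ κ.ord
  ord_mem : ∀ α ≤ l, α.toZFSet ∈ S
  mem_app : l.toZFSet ∈ j.app κ.ord.toZFSet
  m_mem : m ∈ S
  m_mem_app : m ∈ j.app κ.ord.toZFSet
  m_mem_app_B : m ∈ j.app B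
  ord_mem_m : ∀ α ≤ l, α.toZFSet ∈ m
  exists_ultrafilter : ∀ x ∈ B, x ∈ κ.ord.toZFSet → ∃ μ : Cardinal.{u}, x = μ.ord.toZFSet ∧
    ∃ U, IsFineUltrafilter δ l μ U

namespace SeedData

variable {δ l : Ordinal.{u}} {κ : Cardinal.{u}} (d : SeedData δ l κ)

/-- The ultrafilter derived from a seed. -/
noncomputable def E (c : d.S) : Ultrafilter ZFSet.{u} := d.j.derived d.D c (d.subset_app c.2)

/-- The pair of two seeds. -/
noncomputable def pr (a b : d.S) : d.S := ⟨pair a b, d.pair_mem a a.2 b b.2⟩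

/-- An ordinal `≤ l` as a seed. -/
noncomputable def ord (α : Ordinal.{u}) (h : α ≤ l) : d.S := ⟨α.toZFSet, d.ord_mem α h⟩

/-- The sequence of seeds as a seed. -/
noncomputable def seq (a : l.toZFSet → d.S) : d.S := ⟨_, d.seq_mem a⟩

theorem mem_M (c : d.S) : c.1 ∈ d.j.M := d.j.mem_of_mem_app (d.subset_app c.2)

instance (c : d.S) : CountableInterFilter (d.E c : Filter ZFSet.{u}) := by
  unfold E; infer_instance

theorem codes_fst (a b : d.S) : d.j.Codes d.D fst (d.pr a b) a :=
  Emb.codes_fst (d.subset_app (d.pr a b).2) (d.mem_M a) (d.mem_M b)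

theorem codes_snd (a b : d.S) : d.j.Codes d.D snd (d.pr a b) b :=
  Emb.codes_snd (d.subset_app (d.pr a b).2) (d.mem_M a) (d.mem_M b)

theorem pair_mem_seq {a : l.toZFSet → d.S} {x y : ZFSet.{u}} :
    pair x y ∈ (d.seq a).1 ↔ ∃ h : x ∈ l.toZFSet, (a ⟨x, h⟩).1 = y := by
  simp only [seq, mem_range, pair_inj]
  constructor
  · rintro ⟨z, rfl, rfl⟩
    exact ⟨z.2, rfl⟩
  · rintro ⟨h, rfl⟩
    exact ⟨⟨x, h⟩, rfl, rfl⟩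

/-- A generic assignment of elements of the universe to seeds. -/
structure IsGeneric (G : Ultrafilter (d.S → ZFSet.{u})) : Prop where
  eventually_iff : ∀ (c : d.S) (P : ZFSet.{u} → Prop),
    (∀ᶠ p : d.S → ZFSet.{u} in G, P (p c)) ↔ ∀ᶠ x in d.E c, P x
  eventually_eq : ∀ (c a : d.S) (t : ZFSet.{u} → ZFSet.{u}), d.j.Codes d.D t c a →
    ∀ᶠ p : d.S → ZFSet.{u} in G, p a = t (p c)

/-- A family of countably complete ultrafilters that are fine at the relevant points. -/
structure IsFineFamily (U : ZFSet.{u} → Ultrafilter ZFSet.{u}) : Prop where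
  countable : ∀ x, CountableInterFilter (U x : Filter ZFSet.{u})
  fine : ∀ x ∈ d.B, x ∈ κ.ord.toZFSet → ∃ μ : Cardinal.{u}, x = μ.ord.toZFSet ∧
    IsFineUltrafilter δ l μ (U x)

theorem exists_isFineFamily : ∃ U, d.IsFineFamily U := by
  have : ∀ x, ∃ U : Ultrafilter ZFSet.{u}, CountableInterFilter (U : Filter ZFSet.{u}) ∧
      (x ∈ d.B → x ∈ κ.ord.toZFSet → ∃ μ : Cardinal.{u}, x = μ.ord.toZFSet ∧
        IsFineUltrafilter δ l μ U) := by
    intro x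
    by_cases h : x ∈ d.B ∧ x ∈ κ.ord.toZFSet
    · obtain ⟨μ, hμ, U, hU⟩ := d.exists_ultrafilter x h.1 h.2
      exact ⟨U, hU.countable, fun _ _ => ⟨μ, hμ, hU⟩⟩
    -- At irrelevant points any countably complete ultrafilter serves; a principal one is taken.
    · refine ⟨pure ∅, ?_, fun h1 h2 => absurd ⟨h1, h2⟩ h⟩
      rw [Ultrafilter.coe_pure, ← principal_singleton]
      infer_instance
  choose U hU using this
  exact ⟨U, fun x => (hU x).1, fun x => (hU x).2⟩

theorem exists_isGeneric : ∃ G, d.IsGeneric G := by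
  obtain ⟨G, h1, h2⟩ := Emb.exists_generic d.subset_app d.pair_mem ⟨_, d.m_mem⟩
  exact ⟨G, h1, h2⟩

/-- An elementary extension of the universe whose elements are represented by functions of one
seed and of a point chosen by the fine ultrafilter. -/
structure Model where
  G : Ultrafilter (d.S → ZFSet.{u})
  generic : d.IsGeneric G
  U : ZFSet.{u} → Ultrafilter ZFSet.{u}
  fineFamily : d.IsFineFamily U
  H : Type (u + 1)
  str : setLang.Structure H
  cls : (ZFSet.{u} → ZFSet.{u} → ZFSet.{u}) → d.S → H
  exists_rep : ∀ x, ∃ f c, x = cls f c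
  realize : ∀ {ι : Type} {P : ∀ (S : Type (u + 1)) [setLang.Structure S], (ι → S) → Prop}, FO P →
    ∀ (f : ι → ZFSet.{u} → ZFSet.{u} → ZFSet.{u}) (c : ι → d.S),
      P H (fun k => cls (f k) (c k)) ↔
        ∀ᶠ p : d.S → ZFSet.{u} in G, ∀ᶠ g : ZFSet.{u} in U (p ⟨d.m, d.m_mem⟩),
          P ZFSet fun k => f k (p (c k)) g

theorem nonempty_model : Nonempty d.Model := by
  obtain ⟨G, hG⟩ := d.exists_isGeneric
  obtain ⟨U, hU⟩ := d.exists_isFineFamily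
  obtain ⟨H, str, mk, h1, h2⟩ := exists_seedUltrapower G (fun p => U (p ⟨d.m, d.m_mem⟩)) (by
    intro s
    obtain ⟨c, t, ht⟩ := Emb.exists_codes_finset d.subset_app d.pair_mem ⟨_, d.m_mem⟩ s
    exact ⟨c, t, fun a ha => hG.eventually_eq c a _ (ht a ha)⟩)
  exact ⟨⟨G, hG, U, hU, H, str, mk, h1, h2⟩⟩

namespace Model

variable {d} (N : d.Model)

instance : setLang.Structure N.H := N.str

/-- The seed `m`. -/
def mm (_ : d.Model) : d.S := ⟨d.m, d.m_mem⟩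

theorem smem_cls {f g : ZFSet.{u} → ZFSet.{u} → ZFSet.{u}} {c e : d.S} :
    SMem (N.cls f c) (N.cls g e) ↔ ∀ᶠ p : d.S → ZFSet.{u} in N.G,
      ∀ᶠ x : ZFSet.{u} in N.U (p N.mm), f (p c) x ∈ g (p e) x :=
  N.realize (P := fun S _ (v : Bool → S) => SMem (v true) (v false)) (FO.mem _ _)
    (fun b => if b then f else g) (fun b => if b then c else e)

theorem cls_eq {f g : ZFSet.{u} → ZFSet.{u} → ZFSet.{u}} {c e : d.S} :
    N.cls f c = N.cls g e ↔ ∀ᶠ p : d.S → ZFSet.{u} in N.G,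
      ∀ᶠ x : ZFSet.{u} in N.U (p N.mm), f (p c) x = g (p e) x :=
  N.realize (P := fun S _ (v : Bool → S) => v true = v false) (FO.eq _ _)
    (fun b => if b then f else g) (fun b => if b then c else e)

/-- The canonical embedding of the universe. -/
noncomputable def emb : ZFSet.{u} ↪ₑ[setLang] N.H where
  toFun z := N.cls (fun _ _ => z) N.mm
  map_formula' n φ x := by
    have := N.realize (P := fun S _ v => φ.Realize v) ⟨φ, fun _ _ _ => Iff.rfl⟩
      (fun k _ _ => x k) (fun _ => N.mm)
    simpa [Function.comp_def] using this

theorem emb_apply (z : ZFSet.{u}) : N.emb z = N.cls (fun _ _ => z) N.mm := rfl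

theorem eventually_fst (a b : d.S) : ∀ᶠ p : d.S → ZFSet.{u} in N.G, fst (p (d.pr a b)) = p a :=
  (N.generic.eventually_eq _ _ _ (d.codes_fst a b)).mono fun _ h => h.symm

theorem eventually_snd (a b : d.S) : ∀ᶠ p : d.S → ZFSet.{u} in N.G, snd (p (d.pr a b)) = p b :=
  (N.generic.eventually_eq _ _ _ (d.codes_snd a b)).mono fun _ h => h.symm

theorem eventually_mem {a b : d.S} (h : a.1 ∈ b.1) :
    ∀ᶠ p : d.S → ZFSet.{u} in N.G, p a ∈ p b := by
  have := (N.generic.eventually_iff (d.pr a b) (fun x => fst x ∈ snd x)).2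
    (((d.codes_fst a b).mem_iff (d.subset_app (d.pr a b).2) (d.codes_snd a b)).2 h)
  filter_upwards [this, N.eventually_fst a b, N.eventually_snd a b] with p hp h1 h2
  rwa [h1, h2] at hp

theorem eventually_mem_app {a : d.S} {X : ZFSet.{u}} :
    (∀ᶠ p : d.S → ZFSet.{u} in N.G, p a ∈ X) ↔ a.1 ∈ d.j.app X :=
  (N.generic.eventually_iff a (· ∈ X)).trans
    (Emb.eventually_mem_derived_iff (d.subset_app a.2))

theorem eventually_isFine : ∀ᶠ p : d.S → ZFSet.{u} in N.G, p N.mm ∈ κ.ord.toZFSet ∧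
    ∃ μ : Cardinal.{u}, p N.mm = μ.ord.toZFSet ∧ IsFineUltrafilter δ l μ (N.U (p N.mm)) := by
  filter_upwards [(N.eventually_mem_app (a := N.mm)).2 d.m_mem_app_B,
    (N.eventually_mem_app (a := N.mm)).2 d.m_mem_app] with p h1 h2
  exact ⟨h2, N.fineFamily.fine _ h1 h2⟩

/-- The seeds of a descending chain are read off from a single seed, their sequence. Countable
completeness of the ultrafilter of that seed paired with `m`, and then of the fine ultrafilter,
yields one `y` and one `g` at which all the relations hold: a genuine descending `∈`-chain. -/
theorem wellFounded : WellFounded (SMem : N.H → N.H → Prop) := by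
  rw [wellFounded_iff_isEmpty_descending_chain]
  refine ⟨fun ⟨x, hx⟩ => ?_⟩
  choose f c hfc using fun n => N.exists_rep (x n)
  have hω : ∀ n : ℕ, (n : Ordinal.{u}).toZFSet ∈ l.toZFSet := fun n =>
    toZFSet_mem_toZFSet_iff.2 ((natCast_lt_omega0 n).trans_le (d.omega_le.trans d.le))
  -- Seed sequences have length `l ≥ ω`; positions that are not natural numbers are filled with `m`.
  let a : l.toZFSet → d.S := fun z =>
    open Classical in if h : ∃ n : ℕ, (n : Ordinal.{u}).toZFSet = z.1 then c h.choose else N.mm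
  have ha : ∀ n : ℕ, a ⟨_, hω n⟩ = c n := by
    intro n
    have h : ∃ k : ℕ, (k : Ordinal.{u}).toZFSet = (n : Ordinal.{u}).toZFSet := ⟨n, rfl⟩
    have h' : h.choose = n := by
      have := h.choose_spec
      rwa [toZFSet_injective.eq_iff, Nat.cast_inj] at this
    simp only [a]
    rw [dif_pos h, h']
  let t : ℕ → ZFSet.{u} → ZFSet.{u} := fun n => valueAt (n : Ordinal.{u}).toZFSet
  have ht : ∀ n, d.j.Codes d.D (t n) (d.seq a) (c n) := by
    intro n
    refine Emb.codes_valueAt (d.j.app_natCast n) (d.subset_app (d.seq a).2) ?_ (fun y hy => ?_)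
      (d.mem_M _)
    · exact d.pair_mem_seq.2 ⟨hω n, by rw [ha]⟩
    · obtain ⟨_, rfl⟩ := d.pair_mem_seq.1 hy
      rw [ha]
  let e := d.pr (d.seq a) N.mm
  have h1 : ∀ n, ∀ᶠ y : ZFSet.{u} in d.E e, ∀ᶠ g : ZFSet.{u} in N.U (snd y),
      f (n + 1) (t (n + 1) (fst y)) g ∈ f n (t n (fst y)) g := by
    intro n
    rw [← N.generic.eventually_iff]
    have := hx n
    rw [hfc, hfc, smem_cls] at this
    filter_upwards [this, N.generic.eventually_eq _ _ _ (ht n),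
      N.generic.eventually_eq _ _ _ (ht (n + 1)), N.eventually_fst (d.seq a) N.mm,
      N.eventually_snd (d.seq a) N.mm] with p hp hn hn1 h1 h2
    rw [h1, h2, ← hn, ← hn1]
    exact hp
  obtain ⟨y, hy⟩ := (eventually_countable_forall.2 h1).exists
  have := N.fineFamily.countable (snd y)
  obtain ⟨g, hg⟩ := (eventually_countable_forall.2 hy).exists
  exact (wellFounded_iff_isEmpty_descending_chain.1 ZFSet.mem_wf).false ⟨_, hg⟩

/-- A member of `[f, c]` is represented at a pair of seeds by a function on `D × relIndex δ` with
values in the corresponding values of `f`. There is only a set of such functions and of seeds. -/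
theorem small_ext (x : N.H) : Small.{u} {y // SMem y x} := by
  classical
  obtain ⟨f, c, rfl⟩ := N.exists_rep x
  -- Adjoining `∅` gives a value where the membership fails, which is a null event.
  let Ψ : (d.S × ∀ (y : d.D) (g : relIndex δ), (insert ∅ (f (snd y) g) : ZFSet.{u})) → N.H :=
    fun q => N.cls (fun y g => if hy : y ∈ d.D then if hg : g ∈ relIndex δ then
      q.2 ⟨y, hy⟩ ⟨g, hg⟩ else ∅ else ∅) q.1
  have : {y | SMem y (N.cls f c)} ⊆ Set.range Ψ := by
    intro z hz
    obtain ⟨f', c', rfl⟩ := N.exists_rep z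
    rw [Set.mem_ofPred_eq, smem_cls] at hz
    let h : ∀ (y : d.D) (g : relIndex δ), (insert ∅ (f (snd y) g) : ZFSet.{u}) := fun y g =>
      if hm : f' (fst y) g ∈ f (snd y) g then ⟨_, mem_insert_of_mem _ hm⟩ else ⟨∅, mem_insert _ _⟩
    refine ⟨(d.pr c' c, h), ?_⟩
    have hD : ∀ᶠ p : d.S → ZFSet.{u} in N.G, p (d.pr c' c) ∈ d.D :=
      N.eventually_mem_app.2 (d.subset_app (d.pr c' c).2)
    refine N.cls_eq.2 ?_
    filter_upwards [hz, hD, N.eventually_isFine, N.eventually_fst c' c, N.eventually_snd c' c] with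
      p hp hpD ⟨_, μ, _, hμ⟩ h1 h2
    filter_upwards [hp, hμ.mem_relIndex] with g hg hgi
    rw [dif_pos hpD, dif_pos hgi]
    simp only [h, h1, h2, dif_pos hg]
  exact small_subset this

end Model

end SeedData

theorem FunLt.card_lt {x : ZFSet.{u}} {κ : Cardinal.{u}} (h : FunLt x κ.ord.toZFSet) :
    x.card < κ := by
  obtain ⟨⟨β, hβ, h1⟩, h2⟩ := h
  obtain ⟨b, hb, rfl⟩ := mem_toZFSet_iff.1 hβ
  choose s hs y hy using fun w : x => h1 w.1 w.2
  have : Function.Injective fun w : x => (⟨s w, hs w⟩ : b.toZFSet) := by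
    intro w w' hww
    have hss : s w = s w' := congrArg Subtype.val hww
    have hw := w.2
    have hw' := w'.2
    rw [hy] at hw hw'
    rw [← hss] at hw'
    refine Subtype.ext ?_
    rw [hy w, hy w', ← hss, h2 _ _ _ hw hw']
  have h3 := Cardinal.mk_le_of_injective this
  rw [cardinalMk_coe_sort, cardinalMk_coe_sort, Cardinal.lift_le, card_toZFSet] at h3
  exact h3.trans_lt (Cardinal.lt_ord.1 hb)

/-! ### Small ordinals and covering in the model -/

namespace SeedData.Model

variable {δ l : Ordinal.{u}} {κ : Cardinal.{u}} {d : SeedData δ l κ} (N : d.Model)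

/-- An ordinal `≤ l`, viewed as an element of the model. -/
noncomputable def ord (α : Ordinal.{u}) (h : α ≤ l) : N.H := N.cls (fun y _ => y) (d.ord α h)

theorem ord_smem_emb {α : Ordinal.{u}} (h : α ≤ l) {X : ZFSet.{u}} :
    SMem (N.ord α h) (N.emb X) ↔ α.toZFSet ∈ d.j.app X := by
  rw [ord, emb_apply, smem_cls]
  simp only [eventually_const]
  exact N.eventually_mem_app

theorem ord_smem_ord {α β : Ordinal.{u}} (h : α < β) (hβ : β ≤ l) :
    SMem (N.ord α (h.le.trans hβ)) (N.ord β hβ) := by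
  rw [ord, ord, smem_cls]
  simp only [eventually_const]
  exact N.eventually_mem (toZFSet_mem_toZFSet_iff.2 h)

/-- Since `α ∈ m`, the representing function takes values in an ordinal below `p m`, and `U (p m)`
is `p m`-complete, so it is almost surely constant in `g`. The constant depends on one seed only;
the value of `j(h)` at that seed is an element of `α`, hence some `β < α`. -/
theorem eq_ord_of_smem {α : Ordinal.{u}} (hα : α ≤ l) {x : N.H} (hx : SMem x (N.ord α hα)) :
    ∃ (β : Ordinal.{u}) (h : β < α), x = N.ord β (h.le.trans hα) := by
  obtain ⟨f, c, rfl⟩ := N.exists_rep x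
  rw [ord, smem_cls] at hx
  let e := d.pr c N.mm
  -- The almost sure constant value, as a function of the seed `(c, m)`.
  let h : ZFSet.{u} → ZFSet.{u} := fun y => Classical.epsilon fun b =>
    ∀ᶠ g : ZFSet.{u} in N.U (snd y), f (fst y) g = b
  have key : ∀ᶠ p : d.S → ZFSet.{u} in N.G, (∀ᶠ g : ZFSet.{u} in N.U (p N.mm),
      f (p c) g = h (p e)) := by
    have hm : (d.ord α hα).1 ∈ N.mm.1 := d.ord_mem_m α hα
    filter_upwards [hx, N.eventually_isFine, N.eventually_mem hm, N.eventually_fst c N.mm,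
      N.eventually_snd c N.mm] with p hp ⟨_, μ, hμ, hU⟩ hpm h1 h2
    rw [hμ] at hpm
    obtain ⟨γ, hγ, hγp⟩ := mem_toZFSet_iff.1 hpm
    rw [← hγp] at hp
    obtain ⟨β, hβ, hb⟩ := hU.complete γ hγ _ hp
    have : ∀ᶠ g : ZFSet.{u} in N.U (snd (p e)), f (fst (p e)) g = h (p e) :=
      Classical.epsilon_spec (p := fun b => ∀ᶠ g : ZFSet.{u} in N.U (snd (p e)),
        f (fst (p e)) g = b) ⟨β.toZFSet, by rw [h1, h2]; exact hb⟩
    rwa [h1, h2] at this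
  have hmem : ∀ᶠ p : d.S → ZFSet.{u} in N.G, h (p e) ∈ p (d.ord α hα) := by
    filter_upwards [hx, key] with p hp hk
    obtain ⟨g, hg, hg'⟩ := (hp.and hk).exists
    exact hg' ▸ hg
  obtain ⟨b, hb⟩ := Emb.exists_codes (d.subset_app e.2) h
  have hbα : b ∈ α.toZFSet := by
    let e' := d.pr e (d.ord α hα)
    refine (((d.codes_fst e (d.ord α hα)).comp (d.subset_app e'.2) (d.subset_app e.2) hb).mem_iff
      (d.subset_app e'.2) (d.codes_snd e (d.ord α hα))).1 ?_
    refine (N.generic.eventually_iff e' fun x => h (fst x) ∈ snd x).1 ?_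
    filter_upwards [hmem, N.eventually_fst e (d.ord α hα), N.eventually_snd e (d.ord α hα)] with
      p hp h1 h2
    rwa [h1, h2]
  obtain ⟨β, hβ, rfl⟩ := mem_toZFSet_iff.1 hbα
  refine ⟨β, hβ, N.cls_eq.2 ?_⟩
  filter_upwards [key, N.generic.eventually_eq e (d.ord β (hβ.le.trans hα)) h hb] with p hp hpb
  rwa [hpb]

theorem emb_eq_ord {β : Ordinal.{u}} (h : β < κ.ord) :
    N.emb β.toZFSet = N.ord β (h.le.trans d.le) := by
  rw [ord, emb_apply, cls_eq]
  have := (N.generic.eventually_iff (d.ord β (h.le.trans d.le)) (· = β.toZFSet)).2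
    (Emb.eventually_eq_derived _ (d.isCrit.2 β h))
  filter_upwards [this] with p hp
  simp [hp]

/-- The covering property of the model. -/
theorem exists_cover (x : l.toZFSet → N.H) :
    ∃ s : N.H, (∀ ξ, SMem (x ξ) s) ∧ SCardLt s (N.emb κ.ord.toZFSet) := by
  classical
  choose f c hfc using fun ξ => N.exists_rep (x ξ)
  let f' : ZFSet.{u} → ZFSet.{u} → ZFSet.{u} → ZFSet.{u} := fun ξ =>
    if h : ξ ∈ l.toZFSet then f ⟨ξ, h⟩ else fun _ _ => ∅
  -- Elements of `z` are pairs (position, seed value), elements of `g` are pairs with second entry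
  -- an index `ξ`. All combinations are taken, so positions in `z` need not be matched with indices
  -- from `g`.
  let F : ZFSet.{u} → ZFSet.{u} → ZFSet.{u} := fun z g =>
    ZFSet.range fun q : z × g => f' (snd q.2) (snd q.1) g
  have hF : ∀ z g, (F z g).card ≤ z.card * g.card := by
    intro z g
    have := lift_card_range_le (f := fun q : z × g => f' (snd q.2) (snd q.1) g)
    rw [Cardinal.mk_prod, cardinalMk_coe_sort, cardinalMk_coe_sort] at this
    rw [← Cardinal.lift_le.{u + 1}, Cardinal.lift_mul]
    simpa using this
  refine ⟨N.cls F (d.seq c), fun ξ => ?_, ?_⟩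
  · rw [hfc ξ, smem_cls]
    obtain ⟨ξ, hξ⟩ := ξ
    obtain ⟨α, hα, rfl⟩ := mem_toZFSet_iff.1 hξ
    let e := d.pr (c ⟨_, hξ⟩) (d.seq c)
    have h1 : ∀ᶠ z in d.E e, ∃ y, pair y (fst z) ∈ snd z :=
      (d.codes_fst _ _).eventually_mem_range (d.subset_app e.2) (d.codes_snd _ _)
        (d.mem_M (d.ord α hα.le)) (d.pair_mem_seq.2 ⟨hξ, rfl⟩)
    rw [← N.generic.eventually_iff] at h1
    filter_upwards [h1, N.eventually_fst (c ⟨_, hξ⟩) (d.seq c),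
      N.eventually_snd (c ⟨_, hξ⟩) (d.seq c), N.eventually_isFine] with p ⟨y, hy⟩ h2 h3 ⟨_, μ, _, hU⟩
    filter_upwards [hU.fine α hα] with g ⟨s, hs⟩
    rw [h2, h3] at hy
    refine mem_range.2 ⟨(⟨_, hy⟩, ⟨_, hs⟩), ?_⟩
    simp only [snd_pair, f', dif_pos hξ]
  -- The seed sequence has domain `l < j(κ)`, so almost surely its assigned value is a function of
  -- size `< κ`.
  · have h1 : ∀ᶠ p : d.S → ZFSet.{u} in N.G, FunLt (p (d.seq c)) κ.ord.toZFSet := by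
      refine (N.generic.eventually_iff (d.seq c) (FunLt · κ.ord.toZFSet)).2
        (Emb.eventually_funLt_derived _ ⟨⟨_, d.mem_app, fun w hw => ?_⟩, fun s y y' hy hy' => ?_⟩)
      · obtain ⟨ξ, rfl⟩ := mem_range.1 hw
        exact ⟨ξ, ξ.2, _, rfl⟩
      · obtain ⟨_, rfl⟩ := d.pair_mem_seq.1 hy
        obtain ⟨_, rfl⟩ := d.pair_mem_seq.1 hy'
        rfl
    refine (N.realize (P := fun S _ (v : Bool → S) => SCardLt (v true) (v false)) (FO.cardLt _ _)
      (fun b => if b then F else fun _ _ => κ.ord.toZFSet)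
      (fun b => if b then d.seq c else N.mm)).2 ?_
    filter_upwards [h1, N.eventually_isFine] with p hp ⟨hm, μ, hμ, hU⟩
    filter_upwards [hU.funLt] with g hg
    refine scardLt_of_card_lt (s := F (p (d.seq c)) g) ((hF _ _).trans_lt ?_)
    rw [hμ] at hm
    refine Cardinal.mul_lt_of_lt (Cardinal.omega0_le_ord.1 d.omega_le) hp.card_lt
      (hg.of_subset (fun _ h => h) ?_).card_lt
    exact (isOrdinal_toZFSet _).subset_of_mem hm

end SeedData.Model

/-- The collapse sends the class of each seed `α ≤ l` to `α` itself. Hence membership of `α` in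
`i(A)` is decided by the seed, that is by `j(A)`, which also gives `l < i(κ)`. -/
theorem SeedData.exists_emb {δ l : Ordinal.{u}} {κ : Cardinal.{u}} (d : SeedData δ l κ) :
    ∃ i : Emb.{u}, i.CritAbove κ l ∧ i.Covering κ l ∧
      ∀ α < l, ∀ A, α.toZFSet ∈ i.app A ↔ α.toZFSet ∈ d.j.app A := by
  classical
  obtain ⟨N⟩ := d.nonempty_model
  obtain ⟨i, π, hπ, hi⟩ := exists_collapse N.emb N.wellFounded N.small_ext
  have hord : ∀ α (h : α ≤ l), (π (N.ord α h)).1 = α.toZFSet := by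
    intro α
    induction α using WellFoundedLT.induction with
    | _ α ih =>
      intro h
      ext z
      rw [mem_toZFSet_iff]
      constructor
      · intro hz
        obtain ⟨x, hx⟩ := π.surjective ⟨z, i.transitive _ (π (N.ord α h)).2 _ hz⟩
        obtain rfl : (π x).1 = z := congrArg Subtype.val hx
        obtain ⟨β, hβ, rfl⟩ := N.eq_ord_of_smem h ((hπ _ _).1 hz)
        exact ⟨β, hβ, (ih β hβ _).symm⟩
      · rintro ⟨β, hβ, rfl⟩
        rw [← ih β hβ (hβ.le.trans h), hπ]
        exact N.ord_smem_ord hβ h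
  have happ : ∀ z, i.app z = (π (N.emb z)).1 := fun z => congrArg Subtype.val (hi z)
  have hmem : ∀ α ≤ l, ∀ A, α.toZFSet ∈ i.app A ↔ α.toZFSet ∈ d.j.app A := by
    intro α hα A
    rw [happ, ← hord α hα, hπ, N.ord_smem_emb, hord α hα]
  have hl : l.toZFSet ∈ i.app κ.ord.toZFSet := (hmem l le_rfl _).2 d.mem_app
  refine ⟨i, ⟨⟨fun h => ?_, fun β hβ => ?_⟩, hl⟩, fun X hX hcard => ?_, fun α hα => hmem α hα.le⟩
  · rw [h, toZFSet_mem_toZFSet_iff] at hl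
    exact d.le.not_gt hl
  · rw [happ, N.emb_eq_ord hβ, hord]
  · have : Cardinal.mk X ≤ Cardinal.mk l.toZFSet := by
      rwa [cardinalMk_coe_sort, cardinalMk_coe_sort, Cardinal.lift_le, card_toZFSet]
    obtain ⟨g⟩ := this
    have hx : ∀ x : X, ∃ y, (π y).1 = x.1 := fun x => by
      obtain ⟨y, hy⟩ := π.surjective ⟨x, hX x x.2⟩
      exact ⟨y, congrArg Subtype.val hy⟩
    choose r hr using hx
    obtain ⟨s, hs, hs'⟩ := N.exists_cover fun ξ =>
      if h : ∃ x, g x = ξ then r h.choose else N.emb ∅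
    refine ⟨π s, (π s).2, fun x hx => ?_, ?_⟩
    · have h : ∃ y, g y = g ⟨x, hx⟩ := ⟨_, rfl⟩
      have := hs (g ⟨x, hx⟩)
      rw [dif_pos h, g.injective h.choose_spec, ← hπ, hr] at this
      exact this
    · have h := (FO.realize_iff (P := fun S _ (v : Bool → S) => SCardLt (v true) (v false))
        (FO.cardLt _ _) π.toElementaryEmbedding
        (fun b => if b then s else N.emb κ.ord.toZFSet)).2 hs'
      rw [happ]
      exact i.cardLtIn h

/-! ### Seed data from a strong embedding -/

theorem Emb.IsCrit.omega0_le {j : Emb.{u}} {κ : Ordinal.{u}} (h : j.IsCrit κ) :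
    Ordinal.omega0 ≤ κ := by
  by_contra hn
  obtain ⟨n, rfl⟩ := lt_omega0.1 (not_le.1 hn)
  exact h.1 (j.app_natCast n)

theorem rank_pair_lt {o : Ordinal.{u}} (ho : Order.IsSuccLimit o) {x y : ZFSet.{u}}
    (hx : x.rank < o) (hy : y.rank < o) : (pair x y).rank < o := by
  have hx' := ho.succ_lt hx
  have hy' := ho.succ_lt hy
  rw [pair, ZFSet.rank_pair, ZFSet.rank_pair, ZFSet.rank_singleton]
  exact max_lt (ho.succ_lt hx') (ho.succ_lt (max_lt hx' hy'))

theorem rank_range_lt {ν : Cardinal.{u}} (hν : ν.IsRegular) {x : ZFSet.{u}} (hx : x.card < ν)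
    (f : x → ZFSet.{u}) (hf : ∀ i, (f i).rank < ν.ord) : (ZFSet.range f).rank < ν.ord := by
  rw [rank_range]
  refine lift_iSup_lt_of_lt_cof ?_ fun i =>
    (Cardinal.isSuccLimit_ord hν.aleph0_le).succ_lt (hf i)
  rw [← Ordinal.lift_cof, hν.cof_ord, cardinalMk_coe_sort]
  simpa using hx

/-- Slices of a coded set at a fixed tag commute with `j`, so agreement of `C` with `j(C)` passes to
the sets coded in `C`. -/
theorem Emb.pair_mem_app_iff (j : Emb.{u}) {x t C X : ZFSet.{u}} (hx : x ∈ j.M)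
    (ht : j.app t = t) (h : ∀ x, x ∈ X ↔ pair t x ∈ C) :
    x ∈ j.app X ↔ pair t x ∈ j.app C := by
  have := (j.transfer (P := fun S _ (v : Fin 3 → S) => ∀ x, SMem x (v 0) ↔
      ∃ z, SMem z (v 1) ∧ SPair z (v 2) x) (by
    repeat' first
      | exact FO.mem _ _ | exact FO.pair _ _ _ | apply FO.ex | apply FO.all | apply FO.and
      | apply FO.iff) ![X, C, t]).2 (by
    intro x
    refine (h x).trans ⟨fun hx => ⟨_, hx, spair_zfset.2 rfl⟩, fun ⟨z, hz, hzp⟩ => ?_⟩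
    rw [spair_zfset.1 hzp] at hz
    exact hz) ⟨x, hx⟩
  refine this.trans ⟨fun ⟨z, hz, hzp⟩ => ?_, fun h => ?_⟩
  · have hz' : z.1 = pair (j.app t) x := j.spair_iff.1 hzp
    rw [ht] at hz'
    exact hz' ▸ hz
  · exact ⟨⟨_, j.mem_of_mem_app h⟩, h, j.spair_iff.2 (congrArg (pair · x) ht.symm)⟩

/-- Three sets coded by one. -/
noncomputable def tagged (X Y Z : ZFSet.{u}) : ZFSet.{u} :=
  prod {((0 : ℕ) : Ordinal.{u}).toZFSet} X ∪ prod {((1 : ℕ) : Ordinal.{u}).toZFSet} Y ∪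
    prod {((2 : ℕ) : Ordinal.{u}).toZFSet} Z

theorem pair_mem_tagged {X Y Z x : ZFSet.{u}} :
    (pair ((0 : ℕ) : Ordinal.{u}).toZFSet x ∈ tagged X Y Z ↔ x ∈ X) ∧
    (pair ((1 : ℕ) : Ordinal.{u}).toZFSet x ∈ tagged X Y Z ↔ x ∈ Y) ∧
    (pair ((2 : ℕ) : Ordinal.{u}).toZFSet x ∈ tagged X Y Z ↔ x ∈ Z) := by
  simp only [tagged, mem_union, pair_mem_prod, mem_singleton, toZFSet_injective.eq_iff,
    Nat.cast_inj]
  simp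

theorem tagged_subset {o : Ordinal.{u}} (ho : Order.IsSuccLimit o) {X Y Z : ZFSet.{u}}
    (hX : X ⊆ vonNeumann o) (hY : Y ⊆ vonNeumann o) (hZ : Z ⊆ vonNeumann o) :
    tagged X Y Z ⊆ vonNeumann o := by
  have key : ∀ (n : ℕ) (W : ZFSet.{u}), W ⊆ vonNeumann o →
      prod {(n : Ordinal.{u}).toZFSet} W ⊆ vonNeumann o := by
    intro n W hW z hz
    obtain ⟨a, ha, b, hb, rfl⟩ := mem_prod.1 hz
    rw [mem_singleton] at ha
    subst ha
    refine mem_vonNeumann.2 (rank_pair_lt ho ?_ (mem_vonNeumann.1 (hW hb)))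
    rw [rank_toZFSet]
    exact (natCast_lt_omega0 n).trans_le (omega0_le_of_isSuccLimit ho)
  intro z hz
  simp only [tagged, mem_union] at hz
  rcases hz with (hz | hz) | hz
  · exact key 0 X hX hz
  · exact key 1 Y hY hz
  · exact key 2 Z hZ hz

/-- The set of cardinals below `δ` that are `<δ`-supercompact. -/
noncomputable def supercompacts (δ : Cardinal.{u}) : ZFSet.{u} :=
  δ.ord.toZFSet.sep fun x => ∃ μ : Cardinal.{u}, x = μ.ord.toZFSet ∧
    Below μ δ fun l => IsSupercompact μ l

/-- The seeds are the elements of `V_θ` with `θ = μ⁺`, regular and above `l`, so `V_θ` is closed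
under pairs and `l`-sequences. The point `m` is `μ`, which lies in `j(B)` by the third slice and in
`j(κ)` because `θ < j(κ)`. -/
theorem exists_seedData {δ κ μ : Cardinal.{u}} {A : ZFSet.{u}} {l : Ordinal.{u}} (hl : κ.ord ≤ l)
    (hμ : l < μ.ord) (hμδ : μ < δ) (hs : Below μ δ fun l => IsSupercompact μ l)
    (hsucc : Order.succ μ < δ)
    (h : IsStrongFor κ (Order.succ μ).ord (tagged (vonNeumann δ.ord) A (supercompacts δ))) :
    ∃ d : SeedData δ.ord l κ, ∀ α < l, α.toZFSet ∈ d.j.app A ↔ α.toZFSet ∈ A := by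
  obtain ⟨j, ⟨hcrit, hθ⟩, hV, hC⟩ := h
  have hω := hcrit.omega0_le
  have hμω : Cardinal.aleph0 ≤ μ := Cardinal.omega0_le_ord.1 (hω.trans (hl.trans hμ.le))
  have hreg := Cardinal.isRegular_succ hμω
  have hlim := Cardinal.isSuccLimit_ord hreg.aleph0_le
  have hμθ : μ.ord < (Order.succ μ).ord := Cardinal.ord_lt_ord.2 (Order.lt_succ μ)
  have hθδ : (Order.succ μ).ord < δ.ord := Cardinal.ord_lt_ord.2 hsucc
  have hpair : ∀ a ∈ vonNeumann (Order.succ μ).ord, ∀ b ∈ vonNeumann (Order.succ μ).ord,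
      pair a b ∈ vonNeumann (Order.succ μ).ord := fun a ha b hb =>
    mem_vonNeumann.2 (rank_pair_lt hlim (mem_vonNeumann.1 ha) (mem_vonNeumann.1 hb))
  have hord : ∀ α < (Order.succ μ).ord, α.toZFSet ∈ vonNeumann (Order.succ μ).ord := by
    intro α hα
    rwa [mem_vonNeumann, rank_toZFSet]
  have hslice : ∀ (n : ℕ) (X : ZFSet.{u}), (∀ x, x ∈ X ↔ pair (n : Ordinal.{u}).toZFSet x ∈
      tagged (vonNeumann δ.ord) A (supercompacts δ)) →
      ∀ x ∈ vonNeumann (Order.succ μ).ord, x ∈ j.app X ↔ x ∈ X := by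
    intro n X hX x hx
    have hp : pair (n : Ordinal.{u}).toZFSet x ∈ vonNeumann (Order.succ μ).ord :=
      hpair _ (hord _ ((natCast_lt_omega0 n).trans_le (omega0_le_of_isSuccLimit hlim))) _ hx
    rw [j.pair_mem_app_iff (hV x hx) (j.app_natCast n) hX, hX]
    have := ZFSet.ext_iff.1 hC (pair (n : Ordinal.{u}).toZFSet x)
    simpa [hp] using this.symm
  have hκ : (j.app κ.ord.toZFSet).IsTransitive :=
    j.isTransitive_app (isOrdinal_toZFSet _).isTransitive
  have hmem : ∀ α < (Order.succ μ).ord, α.toZFSet ∈ j.app κ.ord.toZFSet := fun α hα =>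
    hκ _ hθ (toZFSet_mem_toZFSet_iff.2 hα)
  refine ⟨{ j := j, D := vonNeumann δ.ord, S := vonNeumann (Order.succ μ).ord, m := μ.ord.toZFSet,
            B := supercompacts δ, subset_app := ?_, pair_mem := hpair, seq_mem := ?_,
            isCrit := hcrit, le := hl, omega_le := hω, ord_mem := ?_, mem_app := ?_,
            m_mem := ?_, m_mem_app := ?_, m_mem_app_B := ?_, ord_mem_m := ?_,
            exists_ultrafilter := ?_ }, ?_⟩
  · intro x hx
    refine (hslice 0 _ (fun x => pair_mem_tagged.1.symm) x hx).2 ?_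
    exact vonNeumann_subset_of_le hθδ.le hx
  · intro a
    refine mem_vonNeumann.2 (rank_range_lt hreg ?_ _ fun i => ?_)
    · rw [card_toZFSet]
      exact Cardinal.lt_ord.1 (hμ.trans hμθ)
    · refine rank_pair_lt hlim ?_ (mem_vonNeumann.1 (a i).2)
      obtain ⟨α, hα, h⟩ := mem_toZFSet_iff.1 i.2
      rw [← h, rank_toZFSet]
      exact hα.trans (hμ.trans hμθ)
  · exact fun α hα => hord α (hα.trans_lt (hμ.trans hμθ))
  · exact hmem l (hμ.trans hμθ)
  · exact hord _ hμθ
  · exact hmem _ hμθ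
  · refine (hslice 2 _ (fun x => pair_mem_tagged.2.2.symm) _ (hord _ hμθ)).2 ?_
    exact mem_sep.2 ⟨toZFSet_mem_toZFSet_iff.2 (Cardinal.ord_lt_ord.2 hμδ), μ, rfl, hs⟩
  · exact fun α hα => toZFSet_mem_toZFSet_iff.2 (hα.trans_lt hμ)
  -- A cardinal `ν ∈ B` below `κ ≤ l` is in particular `l`-supercompact.
  · intro x hx hxκ
    obtain ⟨-, ν, rfl, hν⟩ := mem_sep.1 hx
    have hνκ := toZFSet_mem_toZFSet_iff.1 hxκ
    have hlδ : l < δ.ord := hμ.trans (hμθ.trans hθδ)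
    exact ⟨ν, rfl, (hν l (hνκ.le.trans hl) hlδ).exists_isFineUltrafilter
      (hνκ.trans_le (hl.trans hlδ.le)) hlδ⟩
  · exact fun α hα => hslice 1 _ (fun x => pair_mem_tagged.2.1.symm) _
      (hord _ (hα.trans (hμ.trans hμθ)))

end LargeCardinal

theorem proposition3p4 (δ : Cardinal.{u})
    (hWoodin : LargeCardinal.IsWoodin δ)
    (hUnbounded : ∀ α : Ordinal.{u}, α < δ.ord →
      ∃ κ : Cardinal.{u}, α < κ.ord ∧ κ < δ ∧
        LargeCardinal.Below κ δ fun l => LargeCardinal.IsSupercompact κ l) :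
    LargeCardinal.IsWoodinForStrongCompactness δ := by
  have hδ : Cardinal.aleph0 ≤ δ := by
    obtain ⟨κ, hκ, h⟩ := hWoodin ∅ (ZFSet.empty_subset _)
    obtain ⟨j, ⟨hcrit, -⟩, -⟩ := h κ.ord le_rfl (Cardinal.ord_lt_ord.2 hκ)
    exact (Cardinal.omega0_le_ord.1 hcrit.omega0_le).trans hκ.le
  intro A hA
  obtain ⟨κ, hκ, h⟩ := hWoodin
    (LargeCardinal.tagged (ZFSet.vonNeumann δ.ord) A (LargeCardinal.supercompacts δ))
    (LargeCardinal.tagged_subset (Cardinal.isSuccLimit_ord hδ) (fun _ h => h)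
      (fun _ h => Ordinal.toZFSet_subset_vonNeumann _ (hA h))
      (fun _ h => Ordinal.toZFSet_subset_vonNeumann _ (ZFSet.sep_subset h)))
  refine ⟨κ, hκ, fun l hl hlδ => ?_⟩
  obtain ⟨μ, hμ, hμδ, hs⟩ := hUnbounded l hlδ
  -- A second supercompact above `μ` serves only to place `μ⁺` below `δ`.
  obtain ⟨ν, hν, hνδ, -⟩ := hUnbounded μ.ord (Cardinal.ord_lt_ord.2 hμδ)
  have hsucc : Order.succ μ < δ := (Order.succ_le_of_lt (Cardinal.ord_lt_ord.1 hν)).trans_lt hνδ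
  obtain ⟨d, hd⟩ := LargeCardinal.exists_seedData hl hμ hμδ hs hsucc
    (h _ (hl.trans (hμ.le.trans (Cardinal.ord_le_ord.2 (Order.le_succ μ))))
      (Cardinal.ord_lt_ord.2 hsucc))
  obtain ⟨i, hcrit, hcov, hi⟩ := d.exists_emb
  refine ⟨i, hcrit, hcov, ZFSet.ext fun x => ?_⟩
  simp only [ZFSet.mem_inter]
  refine and_congr_left fun hx => ?_
  obtain ⟨α, hα, rfl⟩ := Ordinal.mem_toZFSet_iff.1 hx
  rw [hi α hα, hd α hα]
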